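/- **Setting.** Let $\mathrm{Var}_1,\mathrm{Var}_2$ be finite sets of variables and $\mathrm{Val}$ a countable set of values; $S_i=(\mathrm{Var}_i\to \mathrm{Val})$ is the set of states. pWhile commands over $\mathrm{Var}_i$ are $$c ::= \mathsf{skip}\mid x:=e\mid x\xleftarrow{\$} d\mid c;c'\mid \mathsf{if}\ b\ \mathsf{then}\ c\ \mathsf{else}\ c'\mid \mathsf{while}\ b\ \mathsf{do}\ c,$$ where $e$, $d$, $b$ are functions from states to values, to probability distributions on $\mathrm{Val}$, and to booleans. The semantics $[\![c]\!]_\sigma$ of $c$ on a state $\sigma$ is the usual sub-distribution over final states; in particular, writing $r_b$ for the restriction to states satisfying $b$, $[\![\mathsf{while}\ b\ \mathsf{do}\ c]\!]=\sum_{n\ge 0} r_{\neg b}\circ([\![c]\!]\circ r_b)^n$. It extends linearly to sub-distributions. The command $c$ is AST if $[\![c]\!]_\sigma$ has total mass $1$ for every state $\sigma$. Assertions are functions $\psi:S_1\times S_2\to[0,\infty]$ (arbitrary: neither bounded nor finite-valued), and $\mathbb E_\mu[\psi]=\sum\mu\cdot\psi$ with $0\cdot\infty=0$. A coupling of two sub-distributions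 $\mu_1,\mu_2$ is a sub-distribution on the product with marginals $\mu_1$ and $\mu_2$. A judgment $\{\psi\}\,c_1\sim c_2\,\{\phi\}$ is *valid* if for every sub-distribution $\mu$ on $S_1\times S_2$, with marginals $\mu_1,\mu_2$, there is a coupling $\nu$ of $[\![c_1]\!](\mu_1)$ and $[\![c_2]\!](\mu_2)$ with $\mathbb E_\nu[\phi]\le\mathbb E_\mu[\psi]$. It is *$\star$-valid* if for all $\sigma_1,\sigma_2$ there is a coupling $\nu$ of the distributions on $S_i\cup\{\star\}$ obtained from $[\![c_i]\!]_{\sigma_i}$ by putting the missing mass on $\star$, with $\mathbb E_\nu[\phi]\le\psi(\sigma_1,\sigma_2)$, where $\phi$ is extended by $0$ to pairs with a component $\star$. **Proof system.** Write $P\mid\psi$ for the assertion equal to $\psi$ where $P$ holds and to $\infty$ elsewhere. Commands are identified up to the congruence generated by $\mathsf{skip};c\equiv c\equiv c;\mathsf{skip}$. Derivability $\vdash$ is generated by the following rules (a one-sided rule, and NMod, also has its mirror image). - Skip: $\vdash\{\psi\}\,\mathsf{skip}\sim\mathsf{skip}\,\{\psi\}$. - Assign: $\vdash\{\psi[e_1/x_1,e_2/x_2]\}\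 x_1:=e_1\sim x_2:=e_2\ \{\psi\}$. Assign-L: $\vdash\{\psi[e_1/x_1]\}\ x_1:=e_1\sim\mathsf{skip}\ \{\psi\}$. - Seq: from $\{\psi\}\,c_1\sim c_2\,\{\xi\}$ and $\{\xi\}\,c_1'\sim c_2'\,\{\phi\}$ infer $\{\psi\}\,c_1;c_1'\sim c_2;c_2'\,\{\phi\}$. - If: from $\{b_1\wedge b_2\mid\psi\}\,c_1\sim c_2\,\{\phi\}$ and $\{\neg b_1\wedge\neg b_2\mid\psi\}\,c_1'\sim c_2'\,\{\phi\}$ infer $\{b_1\leftrightarrow b_2\mid\psi\}\ \mathsf{if}\ b_1\ \mathsf{then}\ c_1\ \mathsf{else}\ c_1'\sim\mathsf{if}\ b_2\ \mathsf{then}\ c_2\ \mathsf{else}\ c_2'\ \{\phi\}$. If-L: from $\{b_1\mid\psi\}\,c_1\sim c_2\,\{\phi\}$ and $\{\neg b_1\mid\psi\}\,c_1'\sim c_2\,\{\phi\}$ infer $\{\psi\}\ \mathsf{if}\ b_1\ \mathsf{then}\ c_1\ \mathsf{else}\ c_1'\sim c_2\ \{\phi\}$. - While: from $\{b_1\wedge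 b_2\mid\psi\}\,c_1\sim c_2\,\{b_1\leftrightarrow b_2\mid\psi\}$ infer $\{b_1\leftrightarrow b_2\mid\psi\}\ \mathsf{while}\ b_1\ \mathsf{do}\ c_1\sim\mathsf{while}\ b_2\ \mathsf{do}\ c_2\ \{\neg b_1\wedge\neg b_2\mid\psi\}$. While-L: from $\{b_1\mid\psi\}\,c_1\sim\mathsf{skip}\,\{\psi\}$ infer $\{\psi\}\ \mathsf{while}\ b_1\ \mathsf{do}\ c_1\sim\mathsf{skip}\ \{\neg b_1\mid\psi\}$. - Sample: if for all $\sigma_1,\sigma_2$ there is a coupling $\nu$ of $d_1(\sigma_1)$ and $d_2(\sigma_2)$ with $\mathbb E_{(v,w)\sim\nu}[\phi(\sigma_1[v/x_1],\sigma_2[w/x_2])]\le\psi(\sigma_1,\sigma_2)$, infer $\{\psi\}\ x_1\xleftarrow{\$}d_1\sim x_2\xleftarrow{\$}d_2\ \{\phi\}$. Sample-L: $\vdash\{\mathbb E_{v\sim d_1}[\psi[v/x_1]]\}\ x_1\xleftarrow{\$}d_1\sim\mathsf{skip}\ \{\psi\}$. - Conseq: from $\{\psi'\}\,c_1\sim c_2\,\{\phi'\}$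 infer $\{\psi\}\,c_1\sim c_2\,\{\phi\}$, provided that for all sub-distributions $\mu$ on $S_1\times S_2$ and $\mu_i$ on $S_i$, $\mathbb E_\mu[\psi']\ge\inf_\nu\mathbb E_\nu[\phi']$ implies $\mathbb E_\mu[\psi]\ge\inf_\nu\mathbb E_\nu[\phi]$, where $\nu$ ranges over the couplings of $\mu_1$ and $\mu_2$ ($\inf\emptyset=\infty$). - NMod: if $x_1$ is neither assigned nor sampled in $c_1$, from $\{x_1=v\mid\psi\}\,c_1\sim c_2\,\{\phi[v/x_1]\}$ for all $v$ infer $\{\psi\}\,c_1\sim c_2\,\{\phi\}$. - Unbounded-Duality: if $c_1,c_2$ are AST, from $\{\psi+n\}\,c_1\sim c_2\,\{\phi_1\otimes \mathit{id}+\mathit{id}\otimes\phi_2\}$ for all $(n,\phi_1,\phi_2)\in\mathcal Y(\phi)$ infer $\{\psi\}\,c_1\sim c_2\,\{\phi\}$. Here $(\phi_1\otimes\mathit{id}+\mathit{id}\otimes\phi_2)(\sigma_1,\sigma_2)=\phi_1(\sigma_1)+\phi_2(\sigma_2)$, and $\mathcal Y(\phi)$ is the set of triples with $n\in\mathbb N$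 and bounded $\phi_i:S_i\to[0,\infty)$ such that $\phi_1\otimes\mathit{id}+\mathit{id}\otimes\phi_2\le\phi+n$ pointwise. **Proposition (soundness and completeness of eRHL with unbounded duality).** Let $c_1,c_2$ be AST pWhile programs. For all assertions $\psi,\phi:S_1\times S_2\to[0,\infty]$, the following are equivalent: (i) $\vdash\{\psi\}\,c_1\sim c_2\,\{\phi\}$; (ii) $\{\psi\}\,c_1\sim c_2\,\{\phi\}$ is $\star$-valid; (iii) $\{\psi\}\,c_1\sim c_2\,\{\phi\}$ is valid. Moreover, if every loop occurring in $c_1$ and $c_2$ is AST, then for all such $\psi,\phi$ the judgment is valid if and only if it is derivable using While-L and While-R only for AST loops. -/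

import Mathlib

open scoped ENNReal NNReal

namespace ERHL

/-! ## Discrete sub-distributions, expectations, couplings -/

/-- A mass function on `A` is a sub-distribution if its total mass is at most one. -/
def IsSubDist {A : Type*} (μ : A → ℝ≥0∞) : Prop := ∑' a, μ a ≤ 1

/-- Expected value of `φ`, with the convention `0 * ∞ = 0`. -/
noncomputable def expect {A : Type*} (μ : A → ℝ≥0∞) (φ : A → ℝ≥0∞) : ℝ≥0∞ :=
  ∑' a, μ a * φ a

/-- First marginal of a joint mass function. -/
noncomputable def margL {A B : Type*} (μ : A × B → ℝ≥0∞) : A → ℝ≥0∞ :=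
  fun a => ∑' b, μ (a, b)

/-- Second marginal of a joint mass function. -/
noncomputable def margR {A B : Type*} (μ : A × B → ℝ≥0∞) : B → ℝ≥0∞ :=
  fun b => ∑' a, μ (a, b)

/-- `μ` is a coupling of `μ₁` and `μ₂`. -/
def IsCoupling {A B : Type*} (μ : A × B → ℝ≥0∞) (μ₁ : A → ℝ≥0∞) (μ₂ : B → ℝ≥0∞) : Prop :=
  margL μ = μ₁ ∧ margR μ = μ₂

/-- The infimum of the expectation of `φ` over all couplings of `μ₁` and `μ₂`
(which is `∞` if there is no coupling). -/
noncomputable def couplingInf {A B : Type*} (μ₁ : A → ℝ≥0∞) (μ₂ : B → ℝ≥0∞)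
    (φ : A × B → ℝ≥0∞) : ℝ≥0∞ :=
  ⨅ (μ : A × B → ℝ≥0∞) (_ : IsCoupling μ μ₁ μ₂), expect μ φ

/-- Completion of a sub-distribution to a distribution on `A ∪ {⋆}` (`⋆` is `none`):
the missing mass is put on `⋆`. -/
noncomputable def star {A : Type*} (μ : A → ℝ≥0∞) : Option A → ℝ≥0∞
  | none => 1 - ∑' a, μ a
  | some a => μ a

/-- Extension of a relational expectation by `0` to pairs with a component `⋆`. -/
def starExt {A B : Type*} (φ : A × B → ℝ≥0∞) : Option A × Option B → ℝ≥0∞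
  | (some a, some b) => φ (a, b)
  | _ => 0

/-! ## The language pWhile -/

/-- Program states: memories mapping variables to values. -/
abbrev State (Var Val : Type*) := Var → Val

/-- Commands of pWhile. Expressions, guards and distribution expressions are given by their
interpretations as functions of the current state. -/
inductive Cmd (Var Val : Type*) where
  | skip : Cmd Var Val
  | assign (x : Var) (e : State Var Val → Val) : Cmd Var Val
  | sample (x : Var) (d : State Var Val → PMF Val) : Cmd Var Val
  | seq (c c' : Cmd Var Val) : Cmd Var Val
  | cond (b : State Var Val → Bool) (c c' : Cmd Var Val) : Cmd Var Val
  | loop (b : State Var Val → Bool) (c : Cmd Var Val) : Cmd Var Val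

/-- Image of a mass function under a transition kernel. -/
noncomputable def push {A B : Type*} (k : A → B → ℝ≥0∞) (μ : A → ℝ≥0∞) : B → ℝ≥0∞ :=
  fun b => ∑' a, μ a * k a b

/-- Restriction of a mass function to the states where `b` holds. -/
def restrict {A : Type*} (b : A → Bool) (μ : A → ℝ≥0∞) : A → ℝ≥0∞ :=
  fun a => if b a then μ a else 0

/-- Denotational semantics: `sem c σ τ` is the probability that `c`, started in `σ`,
terminates in `τ`. -/
noncomputable def sem {Var Val : Type*} [DecidableEq Var] :
    Cmd Var Val → State Var Val → State Var Val → ℝ≥0∞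
  | .skip, σ => ⇑(PMF.pure σ)
  | .assign x e, σ => ⇑(PMF.pure (Function.update σ x (e σ)))
  | .sample x d, σ => ⇑((d σ).map fun v => Function.update σ x v)
  | .seq c c', σ => push (sem c') (sem c σ)
  | .cond b c c', σ => if b σ then sem c σ else sem c' σ
  | .loop b c, σ => fun τ =>
      ∑' n : ℕ, restrict (fun a => !b a)
        ((fun μ => push (sem c) (restrict b μ))^[n] ⇑(PMF.pure σ)) τ

/-- Output sub-distribution of `c` on an input sub-distribution. -/
noncomputable def run {Var Val : Type*} [DecidableEq Var] (c : Cmd Var Val)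
    (μ : State Var Val → ℝ≥0∞) : State Var Val → ℝ≥0∞ :=
  push (sem c) μ

/-- Almost sure termination: from every initial state, `c` terminates with probability one. -/
def AST {Var Val : Type*} [DecidableEq Var] (c : Cmd Var Val) : Prop :=
  ∀ σ, ∑' τ, sem c σ τ = 1

/-- Every loop that occurs in the command is almost surely terminating. -/
def HAST {Var Val : Type*} [DecidableEq Var] : Cmd Var Val → Prop
  | .skip => True
  | .assign _ _ => True
  | .sample _ _ => True
  | .seq c c' => HAST c ∧ HAST c'
  | .cond _ c c' => HAST c ∧ HAST c'
  | .loop b c => HAST c ∧ AST (.loop b c)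

/-- The variables that are assigned or sampled in a command. -/
def modVars {Var Val : Type*} : Cmd Var Val → Set Var
  | .skip => ∅
  | .assign x _ => {x}
  | .sample x _ => {x}
  | .seq c c' => modVars c ∪ modVars c'
  | .cond _ c c' => modVars c ∪ modVars c'
  | .loop _ c => modVars c

/-- Commands are identified up to `skip; c ≡ c ≡ c; skip`: this is the least congruence with
these two laws. -/
inductive SkipEquiv {Var Val : Type*} : Cmd Var Val → Cmd Var Val → Prop
  | refl (c) : SkipEquiv c c
  | symm {c d} : SkipEquiv c d → SkipEquiv d c
  | trans {c d e} : SkipEquiv c d → SkipEquiv d e → SkipEquiv c e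
  | skip_seq (c) : SkipEquiv (.seq .skip c) c
  | seq_skip (c) : SkipEquiv (.seq c .skip) c
  | seq {c c' d d'} : SkipEquiv c d → SkipEquiv c' d' → SkipEquiv (.seq c c') (.seq d d')
  | cond (b) {c c' d d'} :
      SkipEquiv c d → SkipEquiv c' d' → SkipEquiv (.cond b c c') (.cond b d d')
  | loop (b) {c d} : SkipEquiv c d → SkipEquiv (.loop b c) (.loop b d)

/-! ## Relational assertions and judgments -/

/-- Relational pre-expectations: pairs of states are mapped to extended non-negative reals. -/
abbrev Assn (Var₁ Var₂ Val : Type*) := State Var₁ Val × State Var₂ Val → ℝ≥0∞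

open Classical in
/-- The guarded assertion `P ∣ ψ`: it is `ψ` where `P` holds, and `∞` elsewhere. -/
noncomputable def guard {A : Type*} (P : A → Prop) (ψ : A → ℝ≥0∞) : A → ℝ≥0∞ :=
  fun a => if P a then ψ a else ∞

/-- A bounded non-negative assertion. -/
def IsBdd {A : Type*} (φ : A → ℝ≥0∞) : Prop := ∃ L : ℝ≥0, ∀ a, φ a ≤ L

/-- The split assertion `φ₁ ⊗ id + id ⊗ φ₂`. -/
def split {A B : Type*} (φ₁ : A → ℝ≥0∞) (φ₂ : B → ℝ≥0∞) : A × B → ℝ≥0∞ :=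
  fun p => φ₁ p.1 + φ₂ p.2

/-- The duality set of `φ`: triples `(n, φ₁, φ₂)` with `φ₁`, `φ₂` bounded and
`φ₁ ⊗ id + id ⊗ φ₂ ≤ φ + n`. -/
def dualitySet {A B : Type*} (φ : A × B → ℝ≥0∞) :
    Set (ℕ × (A → ℝ≥0∞) × (B → ℝ≥0∞)) :=
  {t | IsBdd t.2.1 ∧ IsBdd t.2.2 ∧ ∀ p, split t.2.1 t.2.2 p ≤ φ p + (t.1 : ℝ≥0∞)}

section Logic

variable {Var₁ Var₂ Val : Type*} [DecidableEq Var₁] [DecidableEq Var₂]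

/-- Validity of a judgment `{ψ} c₁ ∼ c₂ {φ}` through couplings of the two outputs. -/
def Valid (ψ : Assn Var₁ Var₂ Val) (c₁ : Cmd Var₁ Val) (c₂ : Cmd Var₂ Val)
    (φ : Assn Var₁ Var₂ Val) : Prop :=
  ∀ μ : State Var₁ Val × State Var₂ Val → ℝ≥0∞, IsSubDist μ →
    ∃ ν : State Var₁ Val × State Var₂ Val → ℝ≥0∞,
      IsSubDist ν ∧ IsCoupling ν (run c₁ (margL μ)) (run c₂ (margR μ)) ∧
        expect ν φ ≤ expect μ ψ

/-- Validity of a judgment `{ψ} c₁ ∼ c₂ {φ}` through `⋆`-couplings, that is, couplings of the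
completed outputs. -/
def StarValid (ψ : Assn Var₁ Var₂ Val) (c₁ : Cmd Var₁ Val) (c₂ : Cmd Var₂ Val)
    (φ : Assn Var₁ Var₂ Val) : Prop :=
  ∀ (σ₁ : State Var₁ Val) (σ₂ : State Var₂ Val),
    ∃ ν : Option (State Var₁ Val) × Option (State Var₂ Val) → ℝ≥0∞,
      IsCoupling ν (star (sem c₁ σ₁)) (star (sem c₂ σ₂)) ∧
        expect ν (starExt φ) ≤ ψ (σ₁, σ₂)

/-- Derivability of judgments `{ψ} c₁ ∼ c₂ {φ}` in eRHL extended with the rule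
`unboundedDuality`. If `strict` holds, then the one-sided loop rules carry the additional side
condition that the loop is almost surely terminating; eRHL is the case `strict = False`. -/
inductive Derivable (strict : Prop) :
    Assn Var₁ Var₂ Val → Cmd Var₁ Val → Cmd Var₂ Val → Assn Var₁ Var₂ Val → Prop
  /- Two-sided rules -/
  | skip (ψ) : Derivable strict ψ .skip .skip ψ
  | assign (ψ) (x₁ : Var₁) (e₁ : State Var₁ Val → Val) (x₂ : Var₂)
      (e₂ : State Var₂ Val → Val) :
      Derivable strict
        (fun p => ψ (Function.update p.1 x₁ (e₁ p.1), Function.update p.2 x₂ (e₂ p.2)))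
        (.assign x₁ e₁) (.assign x₂ e₂) ψ
  | seq {ψ ξ φ c₁ c₁' c₂ c₂'} :
      Derivable strict ψ c₁ c₂ ξ → Derivable strict ξ c₁' c₂' φ →
      Derivable strict ψ (.seq c₁ c₁') (.seq c₂ c₂') φ
  | cond {ψ φ c₁ c₁' c₂ c₂'} (b₁ : State Var₁ Val → Bool) (b₂ : State Var₂ Val → Bool) :
      Derivable strict (guard (fun p => b₁ p.1 = true ∧ b₂ p.2 = true) ψ) c₁ c₂ φ →
      Derivable strict (guard (fun p => b₁ p.1 = false ∧ b₂ p.2 = false) ψ) c₁' c₂' φ →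
      Derivable strict (guard (fun p => b₁ p.1 = b₂ p.2) ψ)
        (.cond b₁ c₁ c₁') (.cond b₂ c₂ c₂') φ
  | loop {ψ c₁ c₂} (b₁ : State Var₁ Val → Bool) (b₂ : State Var₂ Val → Bool) :
      Derivable strict (guard (fun p => b₁ p.1 = true ∧ b₂ p.2 = true) ψ) c₁ c₂
        (guard (fun p => b₁ p.1 = b₂ p.2) ψ) →
      Derivable strict (guard (fun p => b₁ p.1 = b₂ p.2) ψ)
        (.loop b₁ c₁) (.loop b₂ c₂)
        (guard (fun p => b₁ p.1 = false ∧ b₂ p.2 = false) ψ)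
  | sample {ψ φ} (x₁ : Var₁) (d₁ : State Var₁ Val → PMF Val) (x₂ : Var₂)
      (d₂ : State Var₂ Val → PMF Val) :
      (∀ σ₁ σ₂, ∃ ν : Val × Val → ℝ≥0∞, IsCoupling ν ⇑(d₁ σ₁) ⇑(d₂ σ₂) ∧
        expect ν (fun v => φ (Function.update σ₁ x₁ v.1, Function.update σ₂ x₂ v.2))
          ≤ ψ (σ₁, σ₂)) →
      Derivable strict ψ (.sample x₁ d₁) (.sample x₂ d₂) φ
  /- One-sided rules -/
  | assignL (ψ) (x₁ : Var₁) (e₁ : State Var₁ Val → Val) :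
      Derivable strict (fun p => ψ (Function.update p.1 x₁ (e₁ p.1), p.2))
        (.assign x₁ e₁) .skip ψ
  | assignR (ψ) (x₂ : Var₂) (e₂ : State Var₂ Val → Val) :
      Derivable strict (fun p => ψ (p.1, Function.update p.2 x₂ (e₂ p.2)))
        .skip (.assign x₂ e₂) ψ
  | sampleL (ψ) (x₁ : Var₁) (d₁ : State Var₁ Val → PMF Val) :
      Derivable strict
        (fun p => expect ⇑(d₁ p.1) (fun v => ψ (Function.update p.1 x₁ v, p.2)))
        (.sample x₁ d₁) .skip ψ
  | sampleR (ψ) (x₂ : Var₂) (d₂ : State Var₂ Val → PMF Val) :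
      Derivable strict
        (fun p => expect ⇑(d₂ p.2) (fun v => ψ (p.1, Function.update p.2 x₂ v)))
        .skip (.sample x₂ d₂) ψ
  | condL {ψ φ c₁ c₁' c₂} (b₁ : State Var₁ Val → Bool) :
      Derivable strict (guard (fun p => b₁ p.1 = true) ψ) c₁ c₂ φ →
      Derivable strict (guard (fun p => b₁ p.1 = false) ψ) c₁' c₂ φ →
      Derivable strict ψ (.cond b₁ c₁ c₁') c₂ φ
  | condR {ψ φ c₁ c₂ c₂'} (b₂ : State Var₂ Val → Bool) :
      Derivable strict (guard (fun p => b₂ p.2 = true) ψ) c₁ c₂ φ →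
      Derivable strict (guard (fun p => b₂ p.2 = false) ψ) c₁ c₂' φ →
      Derivable strict ψ c₁ (.cond b₂ c₂ c₂') φ
  | loopL {ψ c₁} (b₁ : State Var₁ Val → Bool) :
      (strict → AST (.loop b₁ c₁)) →
      Derivable strict (guard (fun p => b₁ p.1 = true) ψ) c₁ .skip ψ →
      Derivable strict ψ (.loop b₁ c₁) .skip (guard (fun p => b₁ p.1 = false) ψ)
  | loopR {ψ c₂} (b₂ : State Var₂ Val → Bool) :
      (strict → AST (.loop b₂ c₂)) →
      Derivable strict (guard (fun p => b₂ p.2 = true) ψ) .skip c₂ ψ →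
      Derivable strict ψ .skip (.loop b₂ c₂) (guard (fun p => b₂ p.2 = false) ψ)
  /- Structural rules -/
  | skipEquiv {ψ φ c₁ c₁' c₂ c₂'} :
      SkipEquiv c₁ c₁' → SkipEquiv c₂ c₂' →
      Derivable strict ψ c₁ c₂ φ → Derivable strict ψ c₁' c₂' φ
  | conseq {ψ ψ' φ φ' c₁ c₂} :
      Derivable strict ψ' c₁ c₂ φ' →
      (∀ (μ : State Var₁ Val × State Var₂ Val → ℝ≥0∞)
        (μ₁ : State Var₁ Val → ℝ≥0∞) (μ₂ : State Var₂ Val → ℝ≥0∞),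
        IsSubDist μ → IsSubDist μ₁ → IsSubDist μ₂ →
        couplingInf μ₁ μ₂ φ' ≤ expect μ ψ' → couplingInf μ₁ μ₂ φ ≤ expect μ ψ) →
      Derivable strict ψ c₁ c₂ φ
  | nmodL {ψ φ c₁ c₂} (x₁ : Var₁) :
      x₁ ∉ modVars c₁ →
      (∀ v : Val, Derivable strict (guard (fun p => p.1 x₁ = v) ψ) c₁ c₂
        (fun p => φ (Function.update p.1 x₁ v, p.2))) →
      Derivable strict ψ c₁ c₂ φ
  | nmodR {ψ φ c₁ c₂} (x₂ : Var₂) :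
      x₂ ∉ modVars c₂ →
      (∀ v : Val, Derivable strict (guard (fun p => p.2 x₂ = v) ψ) c₁ c₂
        (fun p => φ (p.1, Function.update p.2 x₂ v))) →
      Derivable strict ψ c₁ c₂ φ
  | unboundedDuality {ψ φ c₁ c₂} :
      AST c₁ → AST c₂ →
      (∀ (n : ℕ) (φ₁ : State Var₁ Val → ℝ≥0∞) (φ₂ : State Var₂ Val → ℝ≥0∞),
        (n, φ₁, φ₂) ∈ dualitySet φ →
        Derivable strict (fun p => ψ p + (n : ℝ≥0∞)) c₁ c₂ (split φ₁ φ₂)) →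
      Derivable strict ψ c₁ c₂ φ

end Logic

end ERHL

/-! All three notions are compared with `KernelValid`, a form of ⋆-validity that keeps only the
proper part of a ⋆-coupling. For proper part `ν` of a coupling of completions, the mass on (⋆,⋆) is
1 + |ν| - |μ₁| - |μ₂|, so beyond the two marginal bounds the only constraint is |μ₁| + |μ₂| ≤ 1 +
|ν|. Such subcouplings compose along kernels, and they become couplings once both sides have mass
one. For AST commands `KernelValid` thus coincides with ⋆-validity, and with validity by mixing the
couplings over the input in one direction and testing Dirac inputs in the other.

Soundness (`Derivable.kernelValid`) is an induction on derivations. Loops are treated through their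
finite approximations and a compactness argument: [0,∞]^(A×B) is compact by Tychonoff, expectation
is lower semicontinuous, and the tails of fixed marginals prevent mass from escaping to infinity.
Unbounded-Duality is Kantorovich duality for arbitrary costs in [0,∞]
(`exists_isCoupling_of_dual_le`): separation of convex sets in finite dimension
(`exists_plan_of_dual_le`), lifting along finite partitions, and compactness to exhaust the cost by
truncations.

Completeness (`KernelValid.derivable`) uses Unbounded-Duality to reduce to postconditions φ₁ ⊗ id +
id ⊗ φ₂. Their expectation depends only on the marginals, so no clever coupling is needed: the two
commands are run one after the other by one-sided rules, which derive weakest pre-expectations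
(`derivable_wpL`, `derivable_wpR`). -/

namespace ERHL

/-! ### Expectations and transition kernels -/

section Kernels

variable {A B C : Type*}

theorem expect_mono {μ μ' : A → ℝ≥0∞} {φ φ' : A → ℝ≥0∞} (hμ : ∀ a, μ a ≤ μ' a)
    (hφ : ∀ a, φ a ≤ φ' a) : expect μ φ ≤ expect μ' φ' :=
  ENNReal.tsum_le_tsum fun a => mul_le_mul' (hμ a) (hφ a)

theorem expect_one (μ : A → ℝ≥0∞) : expect μ (fun _ => 1) = ∑' a, μ a := by
  simp [expect]

theorem expect_add (μ φ φ' : A → ℝ≥0∞) :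
    expect μ (fun a => φ a + φ' a) = expect μ φ + expect μ φ' := by
  simp [expect, mul_add, ENNReal.tsum_add]

theorem expect_const (μ : A → ℝ≥0∞) (r : ℝ≥0∞) : expect μ (fun _ => r) = (∑' a, μ a) * r := by
  simp [expect, ENNReal.tsum_mul_right]

theorem expect_pure (a : A) (φ : A → ℝ≥0∞) : expect ⇑(PMF.pure a) φ = φ a := by
  classical
  rw [expect, tsum_eq_single a]
  · simp
  · intro b hb
    simp [PMF.pure_apply, hb]

theorem push_pure (k : A → B → ℝ≥0∞) (a : A) : push k ⇑(PMF.pure a) = k a := by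
  funext b
  exact expect_pure a fun a => k a b

theorem push_pure_kernel (μ : A → ℝ≥0∞) : push (fun a => ⇑(PMF.pure a)) μ = μ := by
  classical
  funext b
  rw [push, tsum_eq_single b]
  · simp
  · intro a ha
    simp [PMF.pure_apply, ha.symm]

theorem push_zero (k : A → B → ℝ≥0∞) : push k (fun _ => 0) = fun _ => 0 := by
  funext b
  simp [push]

theorem expect_push (k : A → B → ℝ≥0∞) (μ : A → ℝ≥0∞) (φ : B → ℝ≥0∞) :
    expect (push k μ) φ = expect μ fun a => expect (k a) φ := by
  simp only [expect, push, ← ENNReal.tsum_mul_right, ← ENNReal.tsum_mul_left]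
  rw [ENNReal.tsum_comm]
  simp only [mul_assoc]

theorem push_push (l : B → C → ℝ≥0∞) (k : A → B → ℝ≥0∞) (μ : A → ℝ≥0∞) :
    push l (push k μ) = push (fun a => push l (k a)) μ := by
  funext c
  exact expect_push k μ fun b => l b c

theorem tsum_push (k : A → B → ℝ≥0∞) (μ : A → ℝ≥0∞) :
    ∑' b, push k μ b = expect μ fun a => ∑' b, k a b := by
  rw [← expect_one, expect_push]
  simp only [expect_one]

theorem push_mono {k k' : A → B → ℝ≥0∞} {μ μ' : A → ℝ≥0∞} (hk : ∀ a b, k a b ≤ k' a b)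
    (hμ : ∀ a, μ a ≤ μ' a) (b : B) : push k μ b ≤ push k' μ' b :=
  expect_mono hμ fun a => hk a b

theorem restrict_push (p : B → Bool) (k : A → B → ℝ≥0∞) (μ : A → ℝ≥0∞) :
    restrict p (push k μ) = push (fun a => restrict p (k a)) μ := by
  funext b
  by_cases h : p b = true <;> simp [restrict, push, h]

theorem tsum_pure (a : A) : ∑' b, (PMF.pure a) b = 1 := (PMF.pure a).tsum_coe

theorem restrict_pure (p : A → Bool) (a : A) :
    restrict p ⇑(PMF.pure a) = if p a then ⇑(PMF.pure a) else fun _ => 0 := by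
  classical
  funext b
  by_cases hab : b = a
  · subst hab; by_cases h : p b = true <;> simp [restrict, h]
  · by_cases h : p a = true <;> simp [restrict, h, PMF.pure_apply, hab]

end Kernels

/-! ### Marginals and product masses -/

section Marginals

variable {A B A' B' : Type*}

theorem expect_margL (μ : A × B → ℝ≥0∞) (φ : A → ℝ≥0∞) :
    expect (margL μ) φ = expect μ fun p => φ p.1 := by
  simp only [expect, margL, ENNReal.tsum_prod', ENNReal.tsum_mul_right]

theorem expect_margR (μ : A × B → ℝ≥0∞) (φ : B → ℝ≥0∞) :
    expect (margR μ) φ = expect μ fun p => φ p.2 := by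
  simp only [expect, margR, ENNReal.tsum_prod', ← ENNReal.tsum_mul_right]
  rw [ENNReal.tsum_comm]

theorem tsum_margL (μ : A × B → ℝ≥0∞) : ∑' a, margL μ a = ∑' p, μ p := by
  rw [← expect_one, ← expect_one, expect_margL]

theorem tsum_margR (μ : A × B → ℝ≥0∞) : ∑' b, margR μ b = ∑' p, μ p := by
  rw [← expect_one, ← expect_one, expect_margR]

theorem margL_push (k : A × B → A' × B' → ℝ≥0∞) (μ : A × B → ℝ≥0∞) :
    margL (push k μ) = push (fun p => margL (k p)) μ := by
  funext a
  simp only [margL, push, ← ENNReal.tsum_mul_left]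
  rw [ENNReal.tsum_comm]

theorem margR_push (k : A × B → A' × B' → ℝ≥0∞) (μ : A × B → ℝ≥0∞) :
    margR (push k μ) = push (fun p => margR (k p)) μ := by
  funext a
  simp only [margR, push, ← ENNReal.tsum_mul_left]
  rw [ENNReal.tsum_comm]

theorem push_margL (k : A → A' → ℝ≥0∞) (μ : A × B → ℝ≥0∞) :
    push k (margL μ) = push (fun p => k p.1) μ := by
  funext a
  exact expect_margL μ fun x => k x a

theorem push_margR (k : B → B' → ℝ≥0∞) (μ : A × B → ℝ≥0∞) :
    push k (margR μ) = push (fun p => k p.2) μ := by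
  funext a
  exact expect_margR μ fun x => k x a

theorem le_margL (μ : A × B → ℝ≥0∞) (p : A × B) : μ p ≤ margL μ p.1 :=
  ENNReal.le_tsum (f := fun b => μ (p.1, b)) p.2

theorem le_margR (μ : A × B → ℝ≥0∞) (p : A × B) : μ p ≤ margR μ p.2 :=
  ENNReal.le_tsum (f := fun a => μ (a, p.2)) p.1

/-- The product of two mass functions. -/
noncomputable def prodMass (μ₁ : A → ℝ≥0∞) (μ₂ : B → ℝ≥0∞) : A × B → ℝ≥0∞ := fun p => μ₁ p.1 * μ₂ p.2

theorem margL_prodMass (μ₁ : A → ℝ≥0∞) (μ₂ : B → ℝ≥0∞) :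
    margL (prodMass μ₁ μ₂) = fun a => μ₁ a * ∑' b, μ₂ b := by
  funext a
  simp [margL, prodMass, ENNReal.tsum_mul_left]

theorem margR_prodMass (μ₁ : A → ℝ≥0∞) (μ₂ : B → ℝ≥0∞) :
    margR (prodMass μ₁ μ₂) = fun b => (∑' a, μ₁ a) * μ₂ b := by
  funext a
  simp [margR, prodMass, ENNReal.tsum_mul_right]

theorem tsum_prodMass (μ₁ : A → ℝ≥0∞) (μ₂ : B → ℝ≥0∞) :
    ∑' p, prodMass μ₁ μ₂ p = (∑' a, μ₁ a) * ∑' b, μ₂ b := by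
  rw [← tsum_margL, margL_prodMass, ENNReal.tsum_mul_right]

theorem expect_prodMass (μ₁ : A → ℝ≥0∞) (μ₂ : B → ℝ≥0∞) (φ : A × B → ℝ≥0∞) :
    expect (prodMass μ₁ μ₂) φ = expect μ₁ fun a => expect μ₂ fun b => φ (a, b) := by
  simp only [expect, prodMass, ENNReal.tsum_prod', mul_assoc, ENNReal.tsum_mul_left]

/-- Two mass functions, one below the other, agree if their finite total masses do. -/
theorem eq_of_le_of_tsum_le {μ μ' : A → ℝ≥0∞} (h : ∀ a, μ a ≤ μ' a)
    (hm : ∑' a, μ' a ≤ ∑' a, μ a) (hfin : ∑' a, μ a ≠ ∞) : μ = μ' := by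
  funext a
  refine le_antisymm (h a) (not_lt.1 fun hlt => ?_)
  exact absurd hm (not_le.2 (ENNReal.tsum_lt_tsum hfin h hlt))

end Marginals

/-! ### Loop approximations and properties of the semantics -/

section Semantics

variable {Var Val : Type*} [DecidableEq Var]

/-- The output of the loop on the runs that leave it after exactly `n` iterations. -/
noncomputable def loopExit (b : State Var Val → Bool) (c : Cmd Var Val) (n : ℕ)
    (σ : State Var Val) : State Var Val → ℝ≥0∞ :=
  restrict (fun a => !b a) ((fun μ => push (sem c) (restrict b μ))^[n] ⇑(PMF.pure σ))

theorem sem_loop_apply (b : State Var Val → Bool) (c : Cmd Var Val) (σ τ : State Var Val) :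
    sem (.loop b c) σ τ = ∑' n, loopExit b c n σ τ := by
  simp only [sem, loopExit]

theorem iterate_push (b : State Var Val → Bool) (c : Cmd Var Val) (n : ℕ)
    (μ : State Var Val → ℝ≥0∞) :
    (fun μ => push (sem c) (restrict b μ))^[n] μ =
      push (fun σ => (fun μ => push (sem c) (restrict b μ))^[n] ⇑(PMF.pure σ)) μ := by
  induction n with
  | zero => simp [push_pure_kernel]
  | succ n ih =>
    simp only [Function.iterate_succ_apply']
    rw [ih, restrict_push, push_push]

theorem loopExit_zero (b : State Var Val → Bool) (c : Cmd Var Val) (σ : State Var Val) :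
    loopExit b c 0 σ = if b σ then (fun _ => 0) else ⇑(PMF.pure σ) := by
  simp only [loopExit, Function.iterate_zero, id_eq, restrict_pure]
  cases b σ <;> simp

theorem loopExit_succ (b : State Var Val → Bool) (c : Cmd Var Val) (n : ℕ)
    (σ : State Var Val) :
    loopExit b c (n + 1) σ = if b σ then push (loopExit b c n) (sem c σ) else (fun _ => 0) := by
  simp only [loopExit, Function.iterate_succ_apply, restrict_pure]
  rw [iterate_push, restrict_push]
  cases b σ
  · simp [push_zero]
  · simp only [if_true, push_pure]
    rfl

/-- The output of the loop on the runs that leave it after fewer than `n` iterations. -/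
noncomputable def loopApprox (b : State Var Val → Bool) (c : Cmd Var Val) (n : ℕ)
    (σ : State Var Val) : State Var Val → ℝ≥0∞ :=
  fun τ => ∑ k ∈ Finset.range n, loopExit b c k σ τ

theorem loopApprox_zero (b : State Var Val → Bool) (c : Cmd Var Val) (σ : State Var Val) :
    loopApprox b c 0 σ = fun _ => 0 := by
  funext τ
  simp [loopApprox]

/-- The recursion peels off the first iteration, whereas the semantics appends the last one;
linearity of the iterates (`iterate_push`) reconciles the two. Inductions on loops use this form. -/
theorem loopApprox_succ (b : State Var Val → Bool) (c : Cmd Var Val) (n : ℕ)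
    (σ : State Var Val) :
    loopApprox b c (n + 1) σ =
      if b σ then push (loopApprox b c n) (sem c σ) else ⇑(PMF.pure σ) := by
  funext τ
  simp only [loopApprox, Finset.sum_range_succ', loopExit_zero, loopExit_succ]
  cases b σ
  · simp
  · simp only [if_true, add_zero, push, loopApprox, Finset.mul_sum]
    rw [Summable.tsum_finsetSum fun _ _ => ENNReal.summable]

theorem loopApprox_le (b : State Var Val → Bool) (c : Cmd Var Val) (n : ℕ)
    (σ τ : State Var Val) : loopApprox b c n σ τ ≤ sem (.loop b c) σ τ := by
  rw [sem_loop_apply]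
  exact ENNReal.sum_le_tsum _

theorem tsum_loopApprox (b : State Var Val → Bool) (c : Cmd Var Val) (n : ℕ)
    (σ : State Var Val) :
    ∑' τ, loopApprox b c n σ τ = ∑ k ∈ Finset.range n, ∑' τ, loopExit b c k σ τ :=
  Summable.tsum_finsetSum fun _ _ => ENNReal.summable

theorem tsum_loopApprox_mono (b : State Var Val → Bool) (c : Cmd Var Val)
    (σ : State Var Val) : Monotone fun n => ∑' τ, loopApprox b c n σ τ := by
  intro m n h
  simp only [tsum_loopApprox]
  exact Finset.sum_le_sum_of_subset (Finset.range_mono h)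

theorem tsum_sem_loop (b : State Var Val → Bool) (c : Cmd Var Val) (σ : State Var Val) :
    ∑' τ, sem (.loop b c) σ τ = ⨆ n, ∑' τ, loopApprox b c n σ τ := by
  simp only [sem_loop_apply, tsum_loopApprox]
  rw [ENNReal.tsum_comm, ENNReal.tsum_eq_iSup_nat]

theorem sem_loop_unfold (b : State Var Val → Bool) (c : Cmd Var Val) (σ : State Var Val) :
    sem (.loop b c) σ =
      if b σ then push (sem (.loop b c)) (sem c σ) else ⇑(PMF.pure σ) := by
  funext τ
  rw [sem_loop_apply, tsum_eq_zero_add' ENNReal.summable]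
  simp only [loopExit_zero, loopExit_succ]
  cases b σ
  · simp
  · simp only [if_true, zero_add, push, sem_loop_apply, ← ENNReal.tsum_mul_left]
    rw [ENNReal.tsum_comm]

theorem sem_sample (x : Var) (d : State Var Val → PMF Val) (σ : State Var Val) :
    sem (.sample x d) σ = push (fun v => ⇑(PMF.pure (Function.update σ x v))) ⇑(d σ) := by
  funext τ
  simp only [sem, push, ← PMF.bind_pure_comp, PMF.bind_apply, Function.comp_apply]

theorem tsum_push_le {A B : Type*} {k : A → B → ℝ≥0∞} {μ : A → ℝ≥0∞}
    (hk : ∀ a, ∑' b, k a b ≤ 1) (hμ : ∑' a, μ a ≤ 1) : ∑' b, push k μ b ≤ 1 := by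
  rw [tsum_push]
  exact (expect_mono (fun _ => le_rfl) hk).trans ((expect_one μ).trans_le hμ)

theorem tsum_loopApprox_le (b : State Var Val → Bool) {c : Cmd Var Val}
    (hc : ∀ σ, ∑' τ, sem c σ τ ≤ 1) (n : ℕ) (σ : State Var Val) :
    ∑' τ, loopApprox b c n σ τ ≤ 1 := by
  induction n generalizing σ with
  | zero => simp [loopApprox_zero]
  | succ n ih =>
    rw [loopApprox_succ]
    cases b σ
    · simp
    · simpa using tsum_push_le ih (hc σ)

theorem tsum_sem_le (c : Cmd Var Val) (σ : State Var Val) : ∑' τ, sem c σ τ ≤ 1 := by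
  induction c generalizing σ with
  | skip => exact (tsum_pure σ).le
  | assign x e => exact (tsum_pure _).le
  | sample x d => exact ((d σ).map _).tsum_coe.le
  | seq c c' ih ih' => exact tsum_push_le ih' (ih σ)
  | cond b c c' ih ih' =>
    simp only [sem]
    cases b σ
    · simpa using ih' σ
    · simpa using ih σ
  | loop b c ih =>
    rw [tsum_sem_loop]
    exact iSup_le fun n => tsum_loopApprox_le b ih n σ

theorem push_ne_zero {A B : Type*} {k : A → B → ℝ≥0∞} {μ : A → ℝ≥0∞} {b : B}
    (h : push k μ b ≠ 0) : ∃ a, μ a ≠ 0 ∧ k a b ≠ 0 := by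
  by_contra! hcon
  refine h (ENNReal.tsum_eq_zero.2 fun a => ?_)
  by_cases ha : μ a = 0
  · simp [ha]
  · simp [hcon a ha]

theorem pure_ne_zero {A : Type*} {a b : A} (h : (PMF.pure a) b ≠ 0) : b = a := by
  classical
  by_contra hab
  simp [PMF.pure_apply, hab] at h

/-- A command does not change the variables that it neither assigns nor samples. -/
theorem sem_ne_zero_apply_eq {x : Var} {c : Cmd Var Val} (hx : x ∉ modVars c)
    {σ τ : State Var Val} (h : sem c σ τ ≠ 0) : τ x = σ x := by
  induction c generalizing σ τ with
  | skip => rw [pure_ne_zero h]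
  | assign y e =>
    rw [pure_ne_zero h, Function.update_of_ne (by simpa [modVars] using hx)]
  | sample y d =>
    rw [sem_sample] at h
    obtain ⟨v, -, hv⟩ := push_ne_zero h
    rw [pure_ne_zero hv, Function.update_of_ne (by simpa [modVars] using hx)]
  | seq c c' ih ih' =>
    simp only [modVars, Set.mem_union, not_or] at hx
    obtain ⟨ρ, h₁, h₂⟩ := push_ne_zero h
    exact (ih' hx.2 h₂).trans (ih hx.1 h₁)
  | cond b c c' ih ih' =>
    simp only [modVars, Set.mem_union, not_or] at hx
    simp only [sem] at h
    by_cases hb : b σ = true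
    · exact ih hx.1 (by simpa [hb] using h)
    · exact ih' hx.2 (by simpa [hb] using h)
  | loop b c ih =>
    rw [sem_loop_apply] at h
    have h' : ∃ n, loopExit b c n σ τ ≠ 0 := by
      by_contra! hcon
      exact h (ENNReal.tsum_eq_zero.2 hcon)
    obtain ⟨n, hn⟩ := h'
    clear h
    induction n generalizing σ with
    | zero =>
      rw [loopExit_zero] at hn
      by_cases hb : b σ = true
      · simp [hb] at hn
      · rw [pure_ne_zero (a := σ) (b := τ) (by simpa [hb] using hn)]
    | succ n ihn =>
      rw [loopExit_succ] at hn
      by_cases hb : b σ = true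
      · obtain ⟨ρ, h₁, h₂⟩ := push_ne_zero (by simpa [hb] using hn)
        exact (ihn h₂).trans (ih hx h₁)
      · simp [hb] at hn

theorem SkipEquiv.sem_eq {c d : Cmd Var Val} (h : SkipEquiv c d) : sem c = sem d := by
  induction h with
  | refl c => rfl
  | symm _ ih => exact ih.symm
  | trans _ _ ih ih' => exact ih.trans ih'
  | skip_seq c => funext σ; exact push_pure _ σ
  | seq_skip c => funext σ; exact push_pure_kernel _
  | seq _ _ ih ih' => funext σ; simp only [sem, ih, ih']
  | cond b _ _ ih ih' => funext σ; simp only [sem, ih, ih']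
  | loop b _ ih => funext σ; simp only [sem, ih]

theorem HAST.ast {c : Cmd Var Val} (h : HAST c) : AST c := by
  induction c with
  | skip => exact tsum_pure
  | assign x e => exact fun σ => tsum_pure _
  | sample x d => exact fun σ => ((d σ).map _).tsum_coe
  | seq c c' ih ih' =>
    intro σ
    refine (tsum_push _ _).trans ?_
    simp only [ih' h.2 _, expect_one, ih h.1 σ]
  | cond b c c' ih ih' =>
    intro σ
    simp only [sem]
    cases b σ
    · simpa using ih' h.2 σ
    · simpa using ih h.1 σ
  | loop b c ih => exact h.2

end Semantics

/-! ### Closedness and compactness of sets of couplings -/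

section Compactness

variable {A B : Type*}

/-- Joint mass functions whose marginals are bounded by `μ₁` and `μ₂` and whose total mass is at
least `m`. -/
def subcouplings (μ₁ : A → ℝ≥0∞) (μ₂ : B → ℝ≥0∞) (m : ℝ≥0∞) : Set (A × B → ℝ≥0∞) :=
  {ν | (∀ a, margL ν a ≤ μ₁ a) ∧ (∀ b, margR ν b ≤ μ₂ b) ∧ m ≤ ∑' p, ν p}

/-- Tightness: mass outside `F ×ˢ G` lies over the complement of `F` or of `G`, so it is bounded by
tails of `μ₁` and `μ₂`, uniformly in `ν`. -/
theorem tsum_le_sum_product_add {μ₁ : A → ℝ≥0∞} {μ₂ : B → ℝ≥0∞} {ν : A × B → ℝ≥0∞}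
    (h₁ : ∀ a, margL ν a ≤ μ₁ a) (h₂ : ∀ b, margR ν b ≤ μ₂ b) (F : Finset A) (G : Finset B) :
    ∑' p, ν p ≤ ∑ p ∈ F ×ˢ G, ν p + ∑' b : {b // b ∉ G}, μ₂ b + ∑' a : {a // a ∉ F}, μ₁ a := by
  have hF : ∑' p, ν p = ∑ a ∈ F, margL ν a + ∑' a : {a // a ∉ F}, margL ν a := by
    rw [← tsum_margL]
    exact (ENNReal.sum_add_tsum_compl F (margL ν)).symm
  have hG : ∀ a, margL ν a = ∑ b ∈ G, ν (a, b) + ∑' b : {b // b ∉ G}, ν (a, b) := fun a =>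
    (ENNReal.sum_add_tsum_compl G fun b => ν (a, b)).symm
  rw [hF]
  refine add_le_add ?_ (ENNReal.tsum_le_tsum fun a => h₁ a)
  simp only [hG, Finset.sum_add_distrib, Finset.sum_product]
  gcongr
  rw [← Summable.tsum_finsetSum fun _ _ => ENNReal.summable]
  exact ENNReal.tsum_le_tsum fun b => (ENNReal.sum_le_tsum F).trans (h₂ b)

/-- Infinite sums are only lower semicontinuous in the product topology, which suits the upper
bounds on marginals but not the lower bound on mass. Tightness replaces the latter by closed
conditions on finitely many coordinates each; letting `F` and then `G` grow recovers it. -/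
theorem isClosed_subcouplings {μ₁ : A → ℝ≥0∞} {μ₂ : B → ℝ≥0∞} (hμ₁ : ∑' a, μ₁ a ≠ ∞)
    (hμ₂ : ∑' b, μ₂ b ≠ ∞) (m : ℝ≥0∞) : IsClosed (subcouplings μ₁ μ₂ m) := by
  have key : subcouplings μ₁ μ₂ m =
      (⋂ a, {ν | margL ν a ≤ μ₁ a}) ∩ (⋂ b, {ν | margR ν b ≤ μ₂ b}) ∩
      ⋂ F : Finset A, ⋂ G : Finset B, {ν | m ≤ ∑ p ∈ F ×ˢ G, ν p +
        ∑' b : {b // b ∉ G}, μ₂ b + ∑' a : {a // a ∉ F}, μ₁ a} := by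
    ext ν
    simp only [subcouplings, Set.mem_ofPred_eq, Set.mem_inter_iff, Set.mem_iInter, and_assoc]
    refine and_congr_right fun h₁ => and_congr_right fun h₂ =>
      ⟨fun h F G => h.trans (tsum_le_sum_product_add h₁ h₂ F G), fun h => ?_⟩
    have hG : ∀ G : Finset B, m ≤ ∑' p, ν p + ∑' b : {b // b ∉ G}, μ₂ b := by
      intro G
      have ht := (ENNReal.tendsto_tsum_compl_atTop_zero hμ₁).const_add
        (∑' p, ν p + ∑' b : {b // b ∉ G}, μ₂ b)
      rw [add_zero] at ht
      refine ge_of_tendsto' ht fun F => (h F G).trans ?_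
      gcongr
      exact ENNReal.sum_le_tsum _
    have ht := (ENNReal.tendsto_tsum_compl_atTop_zero hμ₂).const_add (∑' p, ν p)
    rw [add_zero] at ht
    exact ge_of_tendsto' ht hG
  rw [key]
  refine (IsClosed.inter ?_ ?_).inter ?_
  · refine isClosed_iInter fun a => ?_
    exact (lowerSemicontinuous_tsum fun b =>
      (continuous_apply (a, b)).lowerSemicontinuous).isClosed_preimage _
  · refine isClosed_iInter fun b => ?_
    exact (lowerSemicontinuous_tsum fun a =>
      (continuous_apply (a, b)).lowerSemicontinuous).isClosed_preimage _
  · refine isClosed_iInter fun F => isClosed_iInter fun G => ?_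
    refine isClosed_le continuous_const ?_
    fun_prop

theorem lowerSemicontinuous_expect (φ : A → ℝ≥0∞) :
    LowerSemicontinuous fun ν : A → ℝ≥0∞ => expect ν φ := by
  refine lowerSemicontinuous_tsum fun a => ?_
  -- Multiplication by ∞ is discontinuous at 0, so it is written as a supremum of continuous
  -- truncations.
  have h : (fun ν : A → ℝ≥0∞ => ν a * φ a) =
      fun ν => ⨆ n : ℕ, ν a * min (φ a) n := by
    funext ν
    rw [← ENNReal.mul_iSup, ← inf_iSup_eq, ENNReal.iSup_natCast, inf_top_eq]
  rw [h]
  refine lowerSemicontinuous_iSup fun n => Continuous.lowerSemicontinuous ?_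
  exact (ENNReal.continuous_mul_const
    (ne_top_of_le_ne_top (ENNReal.natCast_ne_top n) (min_le_right _ _))).comp (continuous_apply a)

theorem isCoupling_iff_mem_subcouplings {μ₁ : A → ℝ≥0∞} {μ₂ : B → ℝ≥0∞}
    (hμ₁ : ∑' a, μ₁ a ≠ ∞) (h : ∑' a, μ₁ a = ∑' b, μ₂ b) {ν : A × B → ℝ≥0∞} :
    IsCoupling ν μ₁ μ₂ ↔ ν ∈ subcouplings μ₁ μ₂ (∑' a, μ₁ a) := by
  constructor
  · rintro ⟨rfl, rfl⟩
    exact ⟨fun _ => le_rfl, fun _ => le_rfl, (tsum_margL ν).le⟩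
  · rintro ⟨h₁, h₂, hm⟩
    have hν : ∑' p, ν p ≠ ∞ := by
      rw [← tsum_margL]
      exact ne_top_of_le_ne_top hμ₁ (ENNReal.tsum_le_tsum h₁)
    constructor
    · exact eq_of_le_of_tsum_le h₁ (by rwa [tsum_margL]) (by rwa [tsum_margL])
    · exact eq_of_le_of_tsum_le h₂ (by rwa [tsum_margR, ← h]) (by rwa [tsum_margR])

theorem IsCoupling.tsum_eq {μ₁ : A → ℝ≥0∞} {μ₂ : B → ℝ≥0∞} {ν : A × B → ℝ≥0∞}
    (h : IsCoupling ν μ₁ μ₂) : ∑' a, μ₁ a = ∑' b, μ₂ b := by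
  rw [← h.1, ← h.2, tsum_margL, tsum_margR]

theorem isClosed_setOf_isCoupling {μ₁ : A → ℝ≥0∞} {μ₂ : B → ℝ≥0∞} (hμ₁ : ∑' a, μ₁ a ≠ ∞)
    (h : ∑' a, μ₁ a = ∑' b, μ₂ b) : IsClosed {ν | IsCoupling ν μ₁ μ₂} := by
  simp only [isCoupling_iff_mem_subcouplings hμ₁ h]
  exact isClosed_subcouplings hμ₁ (h ▸ hμ₁) _

/-- The infimum over couplings is attained. -/
theorem exists_isCoupling_expect_eq_couplingInf {μ₁ : A → ℝ≥0∞} {μ₂ : B → ℝ≥0∞}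
    (hμ₁ : ∑' a, μ₁ a ≠ ∞) (hne : ∃ ν, IsCoupling ν μ₁ μ₂) (φ : A × B → ℝ≥0∞) :
    ∃ ν, IsCoupling ν μ₁ μ₂ ∧ expect ν φ = couplingInf μ₁ μ₂ φ := by
  have hc := isClosed_setOf_isCoupling hμ₁ hne.choose_spec.tsum_eq
  obtain ⟨ν, hν, hmin⟩ := LowerSemicontinuousOn.exists_isMinOn (s := {ν | IsCoupling ν μ₁ μ₂})
    hne hc.isCompact ((lowerSemicontinuous_expect φ).lowerSemicontinuousOn _)
  exact ⟨ν, hν, le_antisymm (le_iInf₂ fun ν' hν' => hmin hν') (iInf₂_le ν hν)⟩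

end Compactness

/-! ### Kantorovich duality -/

section Duality

/-- Finite-dimensional transport duality: a bound on all dual values bounds the cost of some
transport plan. -/
theorem exists_plan_of_dual_le {I J : Type*} [Fintype I] [Fintype J] (p : I → ℝ) (q : J → ℝ)
    (c : I × J → ℝ) (K : ℝ) (hc : ∀ x, 0 ≤ c x) (hp : ∑ i, p i = 1)
    (hdual : ∀ (α : I → ℝ) (β : J → ℝ), (∀ i j, α i + β j ≤ c (i, j)) →
      ∑ i, p i * α i + ∑ j, q j * β j ≤ K) :
    ∃ ν : I × J → ℝ, (∀ x, 0 ≤ ν x) ∧ (∀ i, ∑ j, ν (i, j) = p i) ∧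
      (∀ j, ∑ i, ν (i, j) = q j) ∧ ∑ x, ν x * c x ≤ K := by
  classical
  let Φ : (I × J → ℝ) →ₗ[ℝ] (I → ℝ) × (J → ℝ) × ℝ :=
    { toFun := fun ν => (fun i => ∑ j, ν (i, j), fun j => ∑ i, ν (i, j), ∑ x, ν x * c x)
      map_add' := fun ν ν' => by
        refine Prod.ext ?_ (Prod.ext ?_ ?_)
        · funext i; simp [Finset.sum_add_distrib]
        · funext j; simp [Finset.sum_add_distrib]
        · simp [add_mul, Finset.sum_add_distrib]
      map_smul' := fun r ν => by
        refine Prod.ext ?_ (Prod.ext ?_ ?_)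
        · funext i; simp [Finset.mul_sum]
        · funext j; simp [Finset.mul_sum]
        · simp [Finset.mul_sum, mul_assoc] }
  have hΦ : Continuous Φ := Φ.continuous_of_finiteDimensional
  by_contra hcon
  -- `Φ` sends a plan to its marginals and its cost. Without a plan of cost at most `K`, the compact
  -- image of the simplex can be strictly separated from the target set.
  have hdisj : Disjoint (Φ '' stdSimplex ℝ (I × J))
      (({p} : Set (I → ℝ)) ×ˢ (({q} : Set (J → ℝ)) ×ˢ Set.Iic K)) := by
    rw [Set.disjoint_left]
    rintro _ ⟨ν, hν, rfl⟩ ⟨h₁, h₂, h₃⟩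
    exact hcon ⟨ν, hν.1, fun i => congrFun h₁ i, fun j => congrFun h₂ j, h₃⟩
  obtain ⟨f, u, v, hfu, huv, hfv⟩ := geometric_hahn_banach_compact_closed
    ((convex_stdSimplex ℝ (I × J)).linear_image Φ) ((isCompact_stdSimplex ℝ (I × J)).image hΦ)
    ((convex_singleton p).prod ((convex_singleton q).prod (convex_Iic K)))
    (isClosed_singleton.prod (isClosed_singleton.prod isClosed_Iic)) hdisj
  have hI : ∀ i : I, (fun i' => if i = i' then (1 : ℝ) else 0) = Pi.single i 1 := fun i => by
    funext i'
    simp [Pi.single_apply, eq_comm]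
  have hJ : ∀ j : J, (fun j' => if j = j' then (1 : ℝ) else 0) = Pi.single j 1 := fun j => by
    funext j'
    simp [Pi.single_apply, eq_comm]
  obtain ⟨α, hα⟩ : ∃ α : I → ℝ, ∀ x, f (x, 0, 0) = ∑ i, x i * α i := by
    refine ⟨fun i => f (Pi.single i 1, 0, 0), fun x => ?_⟩
    have := (f.toLinearMap ∘ₗ LinearMap.inl ℝ (I → ℝ) ((J → ℝ) × ℝ)).pi_apply_eq_sum_univ x
    simp only [hI, LinearMap.comp_apply, LinearMap.inl_apply, smul_eq_mul] at this
    exact this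
  obtain ⟨β, hβ⟩ : ∃ β : J → ℝ, ∀ y, f (0, y, 0) = ∑ j, y j * β j := by
    refine ⟨fun j => f (0, Pi.single j 1, 0), fun y => ?_⟩
    have := (f.toLinearMap ∘ₗ LinearMap.inr ℝ (I → ℝ) ((J → ℝ) × ℝ) ∘ₗ
      LinearMap.inl ℝ (J → ℝ) ℝ).pi_apply_eq_sum_univ y
    simp only [hJ, LinearMap.comp_apply, LinearMap.inl_apply, LinearMap.inr_apply, smul_eq_mul] at this
    exact this
  set γ := f (0, 0, 1) with hγ
  have hf : ∀ x y s, f (x, y, s) = ∑ i, x i * α i + ∑ j, y j * β j + s * γ := by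
    intro x y s
    rw [← hα, ← hβ, hγ, ← smul_eq_mul, ← map_smul, ← map_add, ← map_add]
    simp
  -- The separation at the vertices of the simplex, the Dirac plans.
  have hvert : ∀ i j, α i + β j + c (i, j) * γ < u := by
    intro i j
    have h := hfu _ ⟨_, single_mem_stdSimplex ℝ (i, j), rfl⟩
    have hrow : ∀ i', ∑ j', (Pi.single (i, j) 1 : I × J → ℝ) (i', j') = (Pi.single i 1 : I → ℝ) i' := by
      intro i'
      by_cases hi : i' = i
      · subst hi
        rw [Finset.sum_eq_single j] <;> simp +contextual
      · simp [hi]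
    have hcol : ∀ j', ∑ i', (Pi.single (i, j) 1 : I × J → ℝ) (i', j') = (Pi.single j 1 : J → ℝ) j' := by
      intro j'
      by_cases hj : j' = j
      · subst hj
        rw [Finset.sum_eq_single i] <;> simp +contextual
      · simp [hj]
    have hcost : ∑ x, (Pi.single (i, j) 1 : I × J → ℝ) x * c x = c (i, j) := by
      simp [Pi.single_apply]
    have h' : f (fun i' => ∑ j', (Pi.single (i, j) 1 : I × J → ℝ) (i', j'),
        fun j' => ∑ i', (Pi.single (i, j) 1 : I × J → ℝ) (i', j'),
        ∑ x, (Pi.single (i, j) 1 : I × J → ℝ) x * c x) < u := h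
    rw [hf, hcost] at h'
    simp only [hrow, hcol] at h'
    simpa [Pi.single_apply] using h'
  have hbase : ∀ s ≤ K, v < ∑ i, p i * α i + ∑ j, q j * β j + s * γ := by
    intro s hs
    rw [← hf]
    exact hfv _ ⟨rfl, rfl, hs⟩
  set S := ∑ i, p i * α i + ∑ j, q j * β j with hS
  -- The target set is unbounded below in the cost coordinate.
  have hγ0 : γ ≤ 0 := by
    by_contra! hpos
    have h := hbase (min K ((v - S) / γ)) (min_le_left _ _)
    have h' : min K ((v - S) / γ) * γ ≤ (v - S) / γ * γ :=
      mul_le_mul_of_nonneg_right (min_le_right _ _) hpos.le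
    rw [div_mul_cancel₀ _ hpos.ne'] at h'
    linarith
  -- By `hvert` and `c ≥ 0`, the pair `t * (α - u)`, `t * β` is dual feasible; since `p` has mass
  -- one, its value is `t * (S - u)`.
  have hscale : ∀ t : ℝ, 0 ≤ t → t * (-γ) ≤ 1 → t * (S - u) ≤ K := by
    intro t ht htγ
    have h := hdual (fun i => t * (α i - u)) (fun j => t * β j) fun i j => by
      have h₁ : t * (α i - u + β j) ≤ t * (-γ * c (i, j)) :=
        mul_le_mul_of_nonneg_left (by linarith [hvert i j]) ht
      have h₂ : t * -γ * c (i, j) ≤ 1 * c (i, j) := mul_le_mul_of_nonneg_right htγ (hc _)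
      linarith
    have e₁ : ∑ i, p i * (t * (α i - u)) = t * (∑ i, p i * α i - u) := by
      have : ∀ i, p i * (t * (α i - u)) = t * (p i * α i) - p i * (t * u) := fun i => by ring
      simp only [this, Finset.sum_sub_distrib, ← Finset.mul_sum, ← Finset.sum_mul, hp]
      ring
    have e₂ : ∑ j, q j * (t * β j) = t * ∑ j, q j * β j := by
      rw [Finset.mul_sum]
      exact Finset.sum_congr rfl fun j _ => by ring
    rw [e₁, e₂] at h
    rw [hS]
    linarith
  have hK := hbase K le_rfl
  -- If γ < 0, normalizing by `t = 1 / (-γ)` contradicts `hK`. If γ = 0, then `S > u` and every `t ≥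
  -- 0` is allowed, so the dual values are unbounded.
  rcases hγ0.lt_or_eq with hlt | heq
  · have h := hscale (1 / (-γ)) (by have : 0 < -γ := by linarith
                                    positivity)
      (by rw [one_div, inv_mul_cancel₀ (by linarith)])
    rw [one_div, inv_mul_le_iff₀ (by linarith)] at h
    linarith
  · rw [heq] at hK hscale
    have hpos : 0 < S - u := by linarith
    have h := hscale ((|K| + 1) / (S - u)) (by positivity) (by simp)
    rw [div_mul_cancel₀ _ hpos.ne'] at h
    linarith [le_abs_self K]

variable {A B : Type*}

/-- A coupling of image distributions lifts to a coupling of the original ones. -/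
theorem exists_isCoupling_lift {I J : Type*} (f : A → I) (g : B → J) {μ₁ : A → ℝ≥0∞}
    {μ₂ : B → ℝ≥0∞} (hμ₁ : ∑' a, μ₁ a ≠ ∞) (hμ₂ : ∑' b, μ₂ b ≠ ∞) {ν : I × J → ℝ≥0∞}
    (hν : IsCoupling ν (push (fun a => ⇑(PMF.pure (f a))) μ₁)
      (push (fun b => ⇑(PMF.pure (g b))) μ₂)) :
    ∃ ν' : A × B → ℝ≥0∞, IsCoupling ν' μ₁ μ₂ ∧
      ∀ c : I × J → ℝ≥0∞, expect ν' (fun p => c (f p.1, g p.2)) = expect ν c := by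
  set p := push (fun a => ⇑(PMF.pure (f a))) μ₁ with hp
  set q := push (fun b => ⇑(PMF.pure (g b))) μ₂ with hq
  have hpf : ∀ h : I → ℝ≥0∞, expect μ₁ (fun a => h (f a)) = expect p h := fun h => by
    rw [hp, expect_push]; simp only [expect_pure]
  have hqf : ∀ h : J → ℝ≥0∞, expect μ₂ (fun b => h (g b)) = expect q h := fun h => by
    rw [hq, expect_push]; simp only [expect_pure]
  have hp_top : ∀ i, p i ≠ ∞ := fun i => by
    refine ne_top_of_le_ne_top hμ₁ ((ENNReal.le_tsum i).trans ?_)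
    rw [← expect_one, ← hpf, expect_one]
  have hq_top : ∀ j, q j ≠ ∞ := fun j => by
    refine ne_top_of_le_ne_top hμ₂ ((ENNReal.le_tsum j).trans ?_)
    rw [← expect_one, ← hqf, expect_one]
  -- As `0⁻¹ = ∞`, cancellation fails at atoms of mass 0; there the other factor vanishes too.
  have hνp : ∀ x : I × J, ν x * (p x.1 * (p x.1)⁻¹) = ν x := fun x => by
    by_cases h : p x.1 = 0
    · have : ν x = 0 := le_antisymm ((le_margL ν x).trans (by rw [hν.1, h])) zero_le
      simp [this]
    · rw [ENNReal.mul_inv_cancel h (hp_top _), mul_one]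
  have hνq : ∀ x : I × J, ν x * (q x.2 * (q x.2)⁻¹) = ν x := fun x => by
    by_cases h : q x.2 = 0
    · have : ν x = 0 := le_antisymm ((le_margR ν x).trans (by rw [hν.2, h])) zero_le
      simp [this]
    · rw [ENNReal.mul_inv_cancel h (hq_top _), mul_one]
  have hμp : ∀ a, μ₁ a * ((p (f a))⁻¹ * p (f a)) = μ₁ a := fun a => by
    by_cases h : p (f a) = 0
    · have : μ₁ a ≤ p (f a) := by
        have := ENNReal.le_tsum (f := fun x => μ₁ x * (PMF.pure (f x)) (f a)) a
        simp only [PMF.pure_apply_self, mul_one] at this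
        exact this
      have : μ₁ a = 0 := le_antisymm (this.trans h.le) zero_le
      simp [this]
    · rw [ENNReal.inv_mul_cancel h (hp_top _), mul_one]
  have hμq : ∀ b, μ₂ b * ((q (g b))⁻¹ * q (g b)) = μ₂ b := fun b => by
    by_cases h : q (g b) = 0
    · have : μ₂ b ≤ q (g b) := by
        have := ENNReal.le_tsum (f := fun x => μ₂ x * (PMF.pure (g x)) (g b)) b
        simp only [PMF.pure_apply_self, mul_one] at this
        exact this
      have : μ₂ b = 0 := le_antisymm (this.trans h.le) zero_le
      simp [this]
    · rw [ENNReal.inv_mul_cancel h (hq_top _), mul_one]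
  -- Over each pair of fibres the mass of `ν` is spread independently, according to `μ₁` and `μ₂`
  -- conditioned on the fibres.
  refine ⟨fun x => μ₁ x.1 * (μ₂ x.2 * (ν (f x.1, g x.2) * ((p (f x.1))⁻¹ * (q (g x.2))⁻¹))),
    ⟨?_, ?_⟩, ?_⟩
  · funext a
    calc ∑' b, μ₁ a * (μ₂ b * (ν (f a, g b) * ((p (f a))⁻¹ * (q (g b))⁻¹)))
        = μ₁ a * expect μ₂ (fun b => ν (f a, g b) * ((p (f a))⁻¹ * (q (g b))⁻¹)) := by
          rw [ENNReal.tsum_mul_left, expect]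
      _ = μ₁ a * expect q (fun j => ν (f a, j) * ((p (f a))⁻¹ * (q j)⁻¹)) := by rw [hqf
          fun j => ν (f a, j) * ((p (f a))⁻¹ * (q j)⁻¹)]
      _ = μ₁ a * ((p (f a))⁻¹ * margL ν (f a)) := by
          rw [expect, margL, ← ENNReal.tsum_mul_left, ← ENNReal.tsum_mul_left,
            ← ENNReal.tsum_mul_left]
          refine tsum_congr fun j => ?_
          conv_rhs => rw [← hνq (f a, j)]
          ring
      _ = μ₁ a := by rw [hν.1, hμp]
  · funext b
    calc ∑' a, μ₁ a * (μ₂ b * (ν (f a, g b) * ((p (f a))⁻¹ * (q (g b))⁻¹)))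
        = expect μ₁ (fun a => μ₂ b * (ν (f a, g b) * ((p (f a))⁻¹ * (q (g b))⁻¹))) := rfl
      _ = expect p (fun i => μ₂ b * (ν (i, g b) * ((p i)⁻¹ * (q (g b))⁻¹))) := by rw [hpf
          fun i => μ₂ b * (ν (i, g b) * ((p i)⁻¹ * (q (g b))⁻¹))]
      _ = μ₂ b * ((q (g b))⁻¹ * margR ν (g b)) := by
          rw [expect, margR, ← ENNReal.tsum_mul_left, ← ENNReal.tsum_mul_left]
          refine tsum_congr fun i => ?_
          conv_rhs => rw [← hνp (i, g b)]
          ring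
      _ = μ₂ b := by rw [hν.2, hμq]
  · intro c
    calc _ = expect μ₁ fun a => expect μ₂ fun b =>
          ν (f a, g b) * ((p (f a))⁻¹ * (q (g b))⁻¹) * c (f a, g b) := by
          simp only [expect, ENNReal.tsum_prod', ← ENNReal.tsum_mul_left]
          exact tsum_congr fun a => tsum_congr fun b => by ring
      _ = expect p fun i => expect q fun j => ν (i, j) * ((p i)⁻¹ * (q j)⁻¹) * c (i, j) := by
          rw [← hpf fun i => expect q fun j => ν (i, j) * ((p i)⁻¹ * (q j)⁻¹) * c (i, j)]
          congr 1
          funext a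
          exact hqf fun j => ν (f a, j) * ((p (f a))⁻¹ * (q j)⁻¹) * c (f a, j)
      _ = expect ν c := by
          simp only [expect, ENNReal.tsum_prod', ← ENNReal.tsum_mul_left]
          refine tsum_congr fun i => tsum_congr fun j => ?_
          conv_rhs => rw [← hνq (i, j), ← hνp (i, j)]
          ring

end Duality

section Duality

variable {A B : Type*}

theorem tsum_push_pure {I : Type*} (f : A → I) (μ : A → ℝ≥0∞) :
    ∑' i, push (fun a => ⇑(PMF.pure (f a))) μ i = ∑' a, μ a := by
  rw [tsum_push]
  simp only [tsum_pure, expect_one]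

theorem expect_eq_ofReal_sum {I : Type*} [Fintype I] {μ : I → ℝ≥0∞} (hμ : ∀ i, μ i ≠ ∞)
    {x : I → ℝ} (hx : ∀ i, 0 ≤ x i) :
    expect μ (fun i => ENNReal.ofReal (x i)) = ENNReal.ofReal (∑ i, (μ i).toReal * x i) := by
  rw [expect, tsum_fintype, ENNReal.ofReal_sum_of_nonneg fun i _ => by
    have := hx i
    positivity]
  refine Finset.sum_congr rfl fun i _ => ?_
  rw [ENNReal.ofReal_mul ENNReal.toReal_nonneg, ENNReal.ofReal_toReal (hμ i)]

/-- Transport duality for costs that factor through maps to finite types. -/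
theorem exists_isCoupling_of_dual_le_of_factor {I J : Type*} [Fintype I] [Fintype J]
    (f : A → I) (g : B → J) (c : I × J → ℝ≥0) {μ₁ : A → ℝ≥0∞} {μ₂ : B → ℝ≥0∞}
    (hμ₁ : ∑' a, μ₁ a = 1) (hμ₂ : ∑' b, μ₂ b = 1) {K : ℝ≥0∞} (hK : K ≠ ∞)
    (h : ∀ n φ₁ φ₂, (n, φ₁, φ₂) ∈ dualitySet (fun p : A × B => (c (f p.1, g p.2) : ℝ≥0∞)) →
      expect μ₁ φ₁ + expect μ₂ φ₂ ≤ K + (n : ℝ≥0∞)) :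
    ∃ ν, IsCoupling ν μ₁ μ₂ ∧ expect ν (fun p => (c (f p.1, g p.2) : ℝ≥0∞)) ≤ K := by
  set P := push (fun a => ⇑(PMF.pure (f a))) μ₁ with hP
  set Q := push (fun b => ⇑(PMF.pure (g b))) μ₂ with hQ
  have hP1 : ∑ i, P i = 1 := by rw [← tsum_fintype (L := .unconditional I), hP, tsum_push_pure, hμ₁]
  have hQ1 : ∑ j, Q j = 1 := by rw [← tsum_fintype (L := .unconditional J), hQ, tsum_push_pure, hμ₂]
  have hPt : ∀ i, P i ≠ ∞ := fun i => ne_top_of_le_ne_top ENNReal.one_ne_top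
    ((Finset.single_le_sum (f := P) (fun _ _ => zero_le) (Finset.mem_univ i)).trans hP1.le)
  have hQt : ∀ j, Q j ≠ ∞ := fun j => ne_top_of_le_ne_top ENNReal.one_ne_top
    ((Finset.single_le_sum (f := Q) (fun _ _ => zero_le) (Finset.mem_univ j)).trans hQ1.le)
  have hp1 : ∑ i, (P i).toReal = 1 := by
    rw [← ENNReal.toReal_sum fun i _ => hPt i, hP1, ENNReal.toReal_one]
  have hq1 : ∑ j, (Q j).toReal = 1 := by
    rw [← ENNReal.toReal_sum fun j _ => hQt j, hQ1, ENNReal.toReal_one]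
  obtain ⟨ν, hν0, hν1, hν2, hνc⟩ := exists_plan_of_dual_le (fun i => (P i).toReal)
    (fun j => (Q j).toReal) (fun x => (c x : ℝ)) K.toReal (fun x => (c x).2) hp1 <| by
    intro α β hαβ
    -- Real potentials are shifted by `N` to become non-negative. The shifts cost `2 * N`, which is
    -- the integer slack in `dualitySet`; it cancels at the end because both marginals have mass
    -- one.
    obtain ⟨N, hN⟩ := exists_nat_ge (∑ i, |α i| + ∑ j, |β j|)
    have hα : ∀ i, |α i| ≤ N := fun i => by
      have := Finset.single_le_sum (f := fun i => |α i|) (fun _ _ => abs_nonneg _)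
        (Finset.mem_univ i)
      have : 0 ≤ ∑ j, |β j| := by positivity
      linarith
    have hβ : ∀ j, |β j| ≤ N := fun j => by
      have := Finset.single_le_sum (f := fun j => |β j|) (fun _ _ => abs_nonneg _)
        (Finset.mem_univ j)
      have : 0 ≤ ∑ i, |α i| := by positivity
      linarith
    have hα0 : ∀ i, 0 ≤ α i + N := fun i => by linarith [abs_le.1 (hα i)]
    have hβ0 : ∀ j, 0 ≤ β j + N := fun j => by linarith [abs_le.1 (hβ j)]
    have hbdd : ∀ x : ℝ, |x| ≤ N → ENNReal.ofReal (x + N) ≤ ((2 * N : ℝ≥0) : ℝ≥0∞) := by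
      intro x hx
      refine ENNReal.ofReal_le_of_le_toReal ?_
      have := (abs_le.1 hx).2
      simp
      linarith
    have hdual := h (2 * N) (fun a => ENNReal.ofReal (α (f a) + N))
      (fun b => ENNReal.ofReal (β (g b) + N))
      ⟨⟨2 * N, fun a => hbdd _ (hα _)⟩, ⟨2 * N, fun b => hbdd _ (hβ _)⟩, fun x => by
        simp only [split]
        rw [← ENNReal.ofReal_add (hα0 _) (hβ0 _), ← ENNReal.ofReal_coe_nnreal,
          ← ENNReal.ofReal_natCast, ← ENNReal.ofReal_add (NNReal.coe_nonneg _) (Nat.cast_nonneg _)]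
        refine ENNReal.ofReal_le_ofReal ?_
        push_cast
        linarith [hαβ (f x.1) (g x.2)]⟩
    have e₁ : expect μ₁ (fun a => ENNReal.ofReal (α (f a) + N)) =
        ENNReal.ofReal (∑ i, (P i).toReal * (α i + N)) := by
      rw [← expect_eq_ofReal_sum hPt hα0, hP, expect_push]
      simp only [expect_pure]
    have e₂ : expect μ₂ (fun b => ENNReal.ofReal (β (g b) + N)) =
        ENNReal.ofReal (∑ j, (Q j).toReal * (β j + N)) := by
      rw [← expect_eq_ofReal_sum hQt hβ0, hQ, expect_push]
      simp only [expect_pure]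
    have n₁ : 0 ≤ ∑ i, (P i).toReal * (α i + N) :=
      Finset.sum_nonneg fun i _ => mul_nonneg ENNReal.toReal_nonneg (hα0 i)
    have n₂ : 0 ≤ ∑ j, (Q j).toReal * (β j + N) :=
      Finset.sum_nonneg fun j _ => mul_nonneg ENNReal.toReal_nonneg (hβ0 j)
    rw [e₁, e₂, ← ENNReal.ofReal_add n₁ n₂, ← ENNReal.ofReal_toReal hK,
      ← ENNReal.ofReal_natCast, ← ENNReal.ofReal_add ENNReal.toReal_nonneg (Nat.cast_nonneg _),
      ENNReal.ofReal_le_ofReal_iff (by positivity)] at hdual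
    simp only [mul_add, Finset.sum_add_distrib, ← Finset.sum_mul, hp1, hq1] at hdual
    push_cast at hdual
    linarith
  obtain ⟨ν', hν', hcost⟩ := exists_isCoupling_lift f g (ν := fun x => ENNReal.ofReal (ν x))
    (hμ₁ ▸ ENNReal.one_ne_top) (hμ₂ ▸ ENNReal.one_ne_top) <| by
    constructor
    · funext i
      rw [margL, tsum_fintype, ← ENNReal.ofReal_sum_of_nonneg fun j _ => hν0 _, hν1,
        ENNReal.ofReal_toReal (hPt i)]
    · funext j
      rw [margR, tsum_fintype, ← ENNReal.ofReal_sum_of_nonneg fun i _ => hν0 _, hν2,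
        ENNReal.ofReal_toReal (hQt j)]
  refine ⟨ν', hν', ?_⟩
  rw [hcost fun x => (c x : ℝ≥0∞), expect, tsum_fintype]
  refine le_trans (le_of_eq ?_) ((ENNReal.ofReal_le_ofReal hνc).trans ENNReal.ofReal_toReal_le)
  rw [ENNReal.ofReal_sum_of_nonneg fun x _ => mul_nonneg (hν0 x) (NNReal.coe_nonneg _)]
  refine Finset.sum_congr rfl fun x _ => ?_
  rw [ENNReal.ofReal_mul (hν0 x), ENNReal.ofReal_coe_nnreal]

theorem expect_le_of_forall_finset {μ φ : A → ℝ≥0∞} (hμ : ∀ a, μ a ≠ ∞) {K : ℝ≥0∞}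
    (h : ∀ (T : Finset A) (n : ℕ), ∑ a ∈ T, μ a * min (φ a) n ≤ K) : expect μ φ ≤ K := by
  rw [expect, ENNReal.tsum_eq_iSup_sum]
  refine iSup_le fun T => ?_
  have ht : Filter.Tendsto (fun n : ℕ => ∑ a ∈ T, μ a * min (φ a) n) Filter.atTop
      (nhds (∑ a ∈ T, μ a * φ a)) := by
    refine tendsto_finsetSum _ fun a _ => ENNReal.Tendsto.const_mul ?_ (Or.inr (hμ a))
    have := (tendsto_const_nhds (x := φ a)).min ENNReal.tendsto_nat_nhds_top
    simpa using this
  exact le_of_tendsto' ht (h T)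

/-- Kantorovich duality for discrete distributions and costs with values in `[0, ∞]`. -/
theorem exists_isCoupling_of_dual_le {μ₁ : A → ℝ≥0∞} {μ₂ : B → ℝ≥0∞}
    (hμ₁ : ∑' a, μ₁ a = 1) (hμ₂ : ∑' b, μ₂ b = 1) {φ : A × B → ℝ≥0∞} {K : ℝ≥0∞}
    (h : ∀ n φ₁ φ₂, (n, φ₁, φ₂) ∈ dualitySet φ →
      expect μ₁ φ₁ + expect μ₂ φ₂ ≤ K + (n : ℝ≥0∞)) :
    ∃ ν, IsCoupling ν μ₁ μ₂ ∧ expect ν φ ≤ K := by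
  classical
  by_cases hK : K = ∞
  · refine ⟨prodMass μ₁ μ₂, ⟨?_, ?_⟩, hK ▸ le_top⟩
    · simp [margL_prodMass, hμ₂]
    · simp [margR_prodMass, hμ₁]
  have hclosed := isClosed_setOf_isCoupling (μ₁ := μ₁) (μ₂ := μ₂)
    (hμ₁ ▸ ENNReal.one_ne_top) (hμ₁.trans hμ₂.symm)
  -- Only finitely many pairs and a bounded part of the cost are tested at a time. The sets shrink
  -- as the test grows, so compactness gives one coupling that passes all tests.
  let S : Finset A × Finset B × ℕ → Set (A × B → ℝ≥0∞) := fun t =>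
    {ν | IsCoupling ν μ₁ μ₂} ∩ {ν | ∑ p ∈ t.1 ×ˢ t.2.1, ν p * min (φ p) t.2.2 ≤ K}
  have hScl : ∀ t, IsClosed (S t) := fun t => by
    refine hclosed.inter (isClosed_le (continuous_finsetSum _ fun p _ => ?_) continuous_const)
    exact (ENNReal.continuous_mul_const (ne_top_of_le_ne_top (ENNReal.natCast_ne_top _)
      (min_le_right _ _))).comp (continuous_apply p)
  have hSne : ∀ t, (S t).Nonempty := by
    rintro ⟨F, G, n⟩
    -- Points outside `F` and `G` collapse to `none`, where the cost is 0. The collapsed cost is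
    -- below `φ`, so its dual triples are also dual for `φ`.
    let f : A → Option F := fun a => if ha : a ∈ F then some ⟨a, ha⟩ else none
    let g : B → Option G := fun b => if hb : b ∈ G then some ⟨b, hb⟩ else none
    let c : Option F × Option G → ℝ≥0 := fun x => match x with
      | (some a, some b) => (min (φ (a, b)) n).toNNReal
      | _ => 0
    have hc : ∀ p : A × B, (c (f p.1, g p.2) : ℝ≥0∞) ≤ φ p := by
      rintro ⟨a, b⟩
      by_cases ha : a ∈ F <;> by_cases hb : b ∈ G <;> simp [f, g, c, ha, hb]
    have hcF : ∀ p ∈ F ×ˢ G, (c (f p.1, g p.2) : ℝ≥0∞) = min (φ p) n := by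
      rintro ⟨a, b⟩ hp
      obtain ⟨ha, hb⟩ := Finset.mem_product.1 hp
      simp only at ha hb
      simp [f, g, c, ha, hb]
    obtain ⟨ν, hν, hle⟩ := exists_isCoupling_of_dual_le_of_factor f g c hμ₁ hμ₂ hK
      fun m φ₁ φ₂ hm => h m φ₁ φ₂ ⟨hm.1, hm.2.1, fun p =>
        (hm.2.2 p).trans (add_le_add_left (hc p) _)⟩
    refine ⟨ν, hν, le_trans ?_ hle⟩
    refine le_trans (le_of_eq ?_) (ENNReal.sum_le_tsum (F ×ˢ G))
    exact Finset.sum_congr rfl fun p hp => congrArg (ν p * ·) (hcF p hp).symm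
  have hSdir : Directed (· ⊇ ·) S := by
    have hanti : Antitone S := by
      rintro ⟨F, G, n⟩ ⟨F', G', n'⟩ ⟨hF, hG, hn⟩ ν ⟨hν, hle⟩
      refine ⟨hν, LE.le.trans (b := ∑ p ∈ F' ×ˢ G', ν p * min (φ p) n') ?_ hle⟩
      refine (Finset.sum_le_sum fun p _ => ?_).trans
        (Finset.sum_le_sum_of_subset (Finset.product_subset_product hF hG))
      gcongr
    exact hanti.directed_ge
  obtain ⟨ν, hν⟩ := IsCompact.nonempty_iInter_of_directed_nonempty_isCompact_isClosed S hSdir hSne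
    (fun t => (hScl t).isCompact) hScl
  rw [Set.mem_iInter] at hν
  have hνc : IsCoupling ν μ₁ μ₂ := (hν (∅, ∅, 0)).1
  refine ⟨ν, hνc, expect_le_of_forall_finset (fun p => ?_) fun T n => ?_⟩
  · refine ne_top_of_le_ne_top ENNReal.one_ne_top ((le_margL ν p).trans ?_)
    rw [hνc.1, ← hμ₁]
    exact ENNReal.le_tsum _
  · refine (Finset.sum_le_sum_of_subset ?_).trans (hν (T.image Prod.fst, T.image Prod.snd, n)).2
    intro p hp
    exact Finset.mem_product.2 ⟨Finset.mem_image_of_mem _ hp, Finset.mem_image_of_mem _ hp⟩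

end Duality

/-! ### Subcouplings and kernel validity -/

section Subcouplings

variable {A B A' B' : Type*}

/-- The part on proper outcomes of a coupling of the completions of two sub-distributions. -/
def IsSubcoupling (ν : A × B → ℝ≥0∞) (μ₁ : A → ℝ≥0∞) (μ₂ : B → ℝ≥0∞) : Prop :=
  (∀ a, margL ν a ≤ μ₁ a) ∧ (∀ b, margR ν b ≤ μ₂ b) ∧
    ∑' a, μ₁ a + ∑' b, μ₂ b ≤ 1 + ∑' p, ν p

/-- The mass condition x + y ≤ 1 + xy is (1 - x)(1 - y) ≥ 0. -/
theorem isSubcoupling_prodMass {μ₁ : A → ℝ≥0∞} {μ₂ : B → ℝ≥0∞} (h₁ : ∑' a, μ₁ a ≤ 1)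
    (h₂ : ∑' b, μ₂ b ≤ 1) : IsSubcoupling (prodMass μ₁ μ₂) μ₁ μ₂ := by
  refine ⟨fun a => ?_, fun b => ?_, ?_⟩
  · rw [margL_prodMass]
    exact mul_le_of_le_one_right' h₂
  · rw [margR_prodMass]
    exact mul_le_of_le_one_left' h₁
  · rw [tsum_prodMass]
    generalize ∑' a, μ₁ a = x at h₁
    generalize ∑' b, μ₂ b = y at h₂
    calc x + y = x + (x * y + (1 - x) * y) := by
          rw [← add_mul, add_tsub_cancel_of_le h₁, one_mul]
      _ ≤ x + (x * y + (1 - x)) := by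
          gcongr
          exact mul_le_of_le_one_right' h₂
      _ = x + (1 - x) + x * y := by ring
      _ = 1 + x * y := by rw [add_tsub_cancel_of_le h₁]

/-- This is (μ' - μ) m ≤ μ' - μ, summed and rearranged to avoid subtraction. -/
theorem expect_add_tsum_le {μ μ' m : A → ℝ≥0∞} (h : ∀ a, μ a ≤ μ' a) (hm : ∀ a, m a ≤ 1) :
    expect μ' m + ∑' a, μ a ≤ ∑' a, μ' a + expect μ m := by
  rw [expect, expect, ← ENNReal.tsum_add, ← ENNReal.tsum_add]
  refine ENNReal.tsum_le_tsum fun a => ?_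
  calc μ' a * m a + μ a = μ a * m a + (μ' a - μ a) * m a + μ a := by
        rw [← add_mul, add_tsub_cancel_of_le (h a)]
    _ ≤ μ a * m a + (μ' a - μ a) + μ a := by
        gcongr
        exact mul_le_of_le_one_right' (hm a)
    _ = μ a + (μ' a - μ a) + μ a * m a := by ring
    _ = μ' a + μ a * m a := by rw [add_tsub_cancel_of_le (h a)]

theorem IsSubcoupling.push {ν : A × B → ℝ≥0∞} {μ₁ : A → ℝ≥0∞} {μ₂ : B → ℝ≥0∞}
    (hν : IsSubcoupling ν μ₁ μ₂) (hμ₁ : ∑' a, μ₁ a ≤ 1) {k₁ : A → A' → ℝ≥0∞}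
    {k₂ : B → B' → ℝ≥0∞} (hk₁ : ∀ a, ∑' x, k₁ a x ≤ 1) (hk₂ : ∀ b, ∑' x, k₂ b x ≤ 1)
    {κ : A × B → A' × B' → ℝ≥0∞} (hκ : ∀ p, IsSubcoupling (κ p) (k₁ p.1) (k₂ p.2)) :
    IsSubcoupling (push κ ν) (push k₁ μ₁) (push k₂ μ₂) := by
  refine ⟨fun a => ?_, fun b => ?_, ?_⟩
  · rw [margL_push]
    refine (push_mono (fun p => (hκ p).1) (fun _ => le_rfl) a).trans ?_
    rw [← push_margL]
    exact push_mono (fun _ _ => le_rfl) hν.1 a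
  · rw [margR_push]
    refine (push_mono (fun p => (hκ p).2.1) (fun _ => le_rfl) b).trans ?_
    rw [← push_margR]
    exact push_mono (fun _ _ => le_rfl) hν.2.1 b
  · have h₁ := expect_add_tsum_le hν.1 hk₁
    have h₂ := expect_add_tsum_le hν.2.1 hk₂
    rw [tsum_margL, expect_margL] at h₁
    rw [tsum_margR, expect_margR] at h₂
    have h₃ : expect ν (fun p => ∑' x, k₁ p.1 x) + expect ν (fun p => ∑' x, k₂ p.2 x) ≤
        ∑' p, ν p + expect ν fun p => ∑' x, κ p x := by
      rw [← expect_one, ← expect_add, ← expect_add]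
      exact expect_mono (fun _ => le_rfl) fun p => (hκ p).2.2
    have hN : ∑' p, ν p ≠ ∞ := by
      rw [← tsum_margL]
      exact ne_top_of_le_ne_top ENNReal.one_ne_top ((ENNReal.tsum_le_tsum hν.1).trans hμ₁)
    rw [tsum_push, tsum_push, tsum_push]
    -- The mass bounds `h₁`, `h₂`, `h₃` and that of `ν` add up to the claim with twice the finite
    -- mass of `ν` on both sides.
    refine (ENNReal.add_le_add_iff_right (ENNReal.add_ne_top.2 ⟨hN, hN⟩)).1 ?_
    calc _ = (expect μ₁ (fun a => ∑' x, k₁ a x) + ∑' p, ν p) +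
          (expect μ₂ (fun a => ∑' x, k₂ a x) + ∑' p, ν p) := by ring
      _ ≤ _ := add_le_add h₁ h₂
      _ = (∑' a, μ₁ a + ∑' b, μ₂ b) + (expect ν (fun p => ∑' x, k₁ p.1 x) +
          expect ν (fun p => ∑' x, k₂ p.2 x)) := by ring
      _ ≤ _ := add_le_add hν.2.2 h₃
      _ = _ := by ring

theorem IsCoupling.isSubcoupling {ν : A × B → ℝ≥0∞} {μ₁ : A → ℝ≥0∞} {μ₂ : B → ℝ≥0∞}
    (h : IsCoupling ν μ₁ μ₂) (hμ₁ : ∑' a, μ₁ a ≤ 1) : IsSubcoupling ν μ₁ μ₂ := by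
  obtain ⟨rfl, rfl⟩ := h
  rw [tsum_margL] at hμ₁
  refine ⟨fun _ => le_rfl, fun _ => le_rfl, ?_⟩
  rw [tsum_margL, tsum_margR]
  exact add_le_add_left hμ₁ _

theorem IsSubcoupling.isCoupling {ν : A × B → ℝ≥0∞} {μ₁ : A → ℝ≥0∞} {μ₂ : B → ℝ≥0∞}
    (h : IsSubcoupling ν μ₁ μ₂) (hμ₁ : ∑' a, μ₁ a = 1) (hμ₂ : ∑' b, μ₂ b = 1) :
    IsCoupling ν μ₁ μ₂ := by
  refine (isCoupling_iff_mem_subcouplings (hμ₁ ▸ ENNReal.one_ne_top) (hμ₁.trans hμ₂.symm)).2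
    ⟨h.1, h.2.1, ?_⟩
  have := h.2.2
  rw [hμ₁, hμ₂] at this
  rw [hμ₁]
  exact (ENNReal.add_le_add_iff_left ENNReal.one_ne_top).1 this

/-- Subcouplings of the approximants already satisfy the marginal bounds of the limit. With the
lower bound on mass growing with `n`, they inhabit a decreasing sequence of compact sets; a common
point works in the limit. -/
theorem exists_isSubcoupling_of_iSup {μ₁ : A → ℝ≥0∞} {μ₂ : B → ℝ≥0∞} {l₁ : ℕ → A → ℝ≥0∞}
    {l₂ : ℕ → B → ℝ≥0∞} (hμ₁ : ∑' a, μ₁ a ≠ ∞) (hμ₂ : ∑' b, μ₂ b ≠ ∞)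
    (hle₁ : ∀ n a, l₁ n a ≤ μ₁ a) (hle₂ : ∀ n b, l₂ n b ≤ μ₂ b)
    (hmono₁ : Monotone fun n => ∑' a, l₁ n a) (hmono₂ : Monotone fun n => ∑' b, l₂ n b)
    (hsup₁ : ∑' a, μ₁ a = ⨆ n, ∑' a, l₁ n a) (hsup₂ : ∑' b, μ₂ b = ⨆ n, ∑' b, l₂ n b)
    {φ : A × B → ℝ≥0∞} {K : ℝ≥0∞}
    (h : ∀ n, ∃ ν, IsSubcoupling ν (l₁ n) (l₂ n) ∧ expect ν φ ≤ K) :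
    ∃ ν, IsSubcoupling ν μ₁ μ₂ ∧ expect ν φ ≤ K := by
  let S : ℕ → Set (A × B → ℝ≥0∞) := fun n =>
    subcouplings μ₁ μ₂ (∑' a, l₁ n a + ∑' b, l₂ n b - 1) ∩ {ν | expect ν φ ≤ K}
  have hScl : ∀ n, IsClosed (S n) := fun n => (isClosed_subcouplings hμ₁ hμ₂ _).inter
    ((lowerSemicontinuous_expect φ).isClosed_preimage K)
  have hSne : ∀ n, (S n).Nonempty := fun n => by
    obtain ⟨ν, hν, hK⟩ := h n
    exact ⟨ν, ⟨fun a => (hν.1 a).trans (hle₁ n a), fun b => (hν.2.1 b).trans (hle₂ n b),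
      tsub_le_iff_left.2 hν.2.2⟩, hK⟩
  have hSanti : Antitone S := fun m n hmn ν hν =>
    ⟨⟨hν.1.1, hν.1.2.1, (tsub_le_tsub_right (add_le_add (hmono₁ hmn) (hmono₂ hmn)) 1).trans
      hν.1.2.2⟩, hν.2⟩
  obtain ⟨ν, hν⟩ := IsCompact.nonempty_iInter_of_directed_nonempty_isCompact_isClosed S
    hSanti.directed_ge hSne (fun n => (hScl n).isCompact) hScl
  rw [Set.mem_iInter] at hν
  refine ⟨ν, ⟨(hν 0).1.1, (hν 0).1.2.1, ?_⟩, (hν 0).2⟩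
  rw [hsup₁, hsup₂, ENNReal.iSup_add_iSup_of_monotone hmono₁ hmono₂]
  exact iSup_le fun n => tsub_le_iff_left.1 (hν n).1.2.2

/-- The analogue of `⋆`-validity for transition kernels. -/
def KernelValid (ψ : A × B → ℝ≥0∞) (k₁ : A → A' → ℝ≥0∞) (k₂ : B → B' → ℝ≥0∞)
    (φ : A' × B' → ℝ≥0∞) : Prop :=
  ∀ a b, ∃ ν, IsSubcoupling ν (k₁ a) (k₂ b) ∧ expect ν φ ≤ ψ (a, b)

theorem exists_isSubcoupling_prodMass {μ₁ : A → ℝ≥0∞} {μ₂ : B → ℝ≥0∞} {φ : A × B → ℝ≥0∞}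
    {K : ℝ≥0∞} (h₁ : ∑' a, μ₁ a ≤ 1) (h₂ : ∑' b, μ₂ b ≤ 1)
    (h : (expect μ₁ fun a => expect μ₂ fun b => φ (a, b)) ≤ K) :
    ∃ ν, IsSubcoupling ν μ₁ μ₂ ∧ expect ν φ ≤ K :=
  ⟨_, isSubcoupling_prodMass h₁ h₂, by rwa [expect_prodMass]⟩

theorem exists_isSubcoupling_pure {a : A} {b : B} {φ : A × B → ℝ≥0∞} {K : ℝ≥0∞}
    (h : φ (a, b) ≤ K) :
    ∃ ν, IsSubcoupling ν ⇑(PMF.pure a) ⇑(PMF.pure b) ∧ expect ν φ ≤ K :=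
  exists_isSubcoupling_prodMass (tsum_pure a).le (tsum_pure b).le
    (by rwa [expect_pure, expect_pure])

theorem KernelValid.exists_push {ξ : A × B → ℝ≥0∞} {k₁ : A → A' → ℝ≥0∞}
    {k₂ : B → B' → ℝ≥0∞} {φ : A' × B' → ℝ≥0∞} (h : KernelValid ξ k₁ k₂ φ)
    (hk₁ : ∀ a, ∑' x, k₁ a x ≤ 1) (hk₂ : ∀ b, ∑' x, k₂ b x ≤ 1) {μ₁ : A → ℝ≥0∞}
    {μ₂ : B → ℝ≥0∞} {K : ℝ≥0∞} (hμ₁ : ∑' a, μ₁ a ≤ 1)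
    (hν : ∃ ν, IsSubcoupling ν μ₁ μ₂ ∧ expect ν ξ ≤ K) :
    ∃ ν, IsSubcoupling ν (push k₁ μ₁) (push k₂ μ₂) ∧ expect ν φ ≤ K := by
  obtain ⟨ν, hν, hK⟩ := hν
  choose κ hκ hκφ using h
  refine ⟨push (fun p : A × B => κ p.1 p.2) ν, hν.push hμ₁ hk₁ hk₂ fun p => hκ p.1 p.2, ?_⟩
  rw [expect_push]
  refine le_trans (expect_mono (fun _ => le_rfl) fun p => ?_) hK
  exact hκφ p.1 p.2

theorem guard_of_pos {P : A → Prop} {a : A} (h : P a) (ψ : A → ℝ≥0∞) : guard P ψ a = ψ a :=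
  if_pos h

theorem guard_of_neg {P : A → Prop} {a : A} (h : ¬P a) (ψ : A → ℝ≥0∞) : guard P ψ a = ∞ :=
  if_neg h

theorem le_guard_of_imp {P : A → Prop} {ψ : A → ℝ≥0∞} {a : A} {x : ℝ≥0∞}
    (h : P a → x ≤ ψ a) : x ≤ guard P ψ a := by
  by_cases hP : P a
  · rw [guard_of_pos hP]
    exact h hP
  · rw [guard_of_neg hP]
    exact le_top

/-- The side condition is applied to a Dirac input and to the marginals of the given subcoupling
`ν`, not to the outputs themselves. An optimal coupling of these marginals has the same marginals
and mass as `ν`, hence is again a subcoupling. -/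
theorem KernelValid.conseq {ψ ψ' : A × B → ℝ≥0∞} {φ φ' : A' × B' → ℝ≥0∞}
    {k₁ : A → A' → ℝ≥0∞} {k₂ : B → B' → ℝ≥0∞}
    (hk₁ : ∀ σ, ∑' τ, k₁ σ τ ≤ 1) (hk₂ : ∀ σ, ∑' τ, k₂ σ τ ≤ 1)
    (h : KernelValid ψ' k₁ k₂ φ')
    (himp : ∀ (μ : A × B → ℝ≥0∞) (μ₁ : A' → ℝ≥0∞) (μ₂ : B' → ℝ≥0∞),
      IsSubDist μ → IsSubDist μ₁ → IsSubDist μ₂ →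
      couplingInf μ₁ μ₂ φ' ≤ expect μ ψ' → couplingInf μ₁ μ₂ φ ≤ expect μ ψ) :
    KernelValid ψ k₁ k₂ φ := by
  intro σ₁ σ₂
  obtain ⟨ν, hν, hle⟩ := h σ₁ σ₂
  have hm₁ : IsSubDist (margL ν) := (ENNReal.tsum_le_tsum hν.1).trans (hk₁ σ₁)
  have hm₂ : IsSubDist (margR ν) := (ENNReal.tsum_le_tsum hν.2.1).trans (hk₂ σ₂)
  have hc := himp ⇑(PMF.pure (σ₁, σ₂)) (margL ν) (margR ν) (tsum_pure _).le hm₁ hm₂ <| by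
    rw [expect_pure]
    exact (iInf₂_le ν ⟨rfl, rfl⟩).trans hle
  obtain ⟨ν', hν', heq⟩ := exists_isCoupling_expect_eq_couplingInf
    (ne_top_of_le_ne_top ENNReal.one_ne_top hm₁) ⟨ν, rfl, rfl⟩ φ
  rw [expect_pure] at hc
  refine ⟨ν', ⟨fun a => hν'.1 ▸ hν.1 a, fun b => hν'.2 ▸ hν.2.1 b, ?_⟩, heq.trans_le hc⟩
  rw [← tsum_margL ν', hν'.1, tsum_margL]
  exact hν.2.2

end Subcouplings

/-! ### Soundness of the rules -/

section Soundness

variable {Var₁ Var₂ Val : Type*} [DecidableEq Var₁] [DecidableEq Var₂]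

theorem kernelValid_loop {ψ : Assn Var₁ Var₂ Val} {c₁ : Cmd Var₁ Val} {c₂ : Cmd Var₂ Val}
    (b₁ : State Var₁ Val → Bool) (b₂ : State Var₂ Val → Bool)
    (h : KernelValid (guard (fun p => b₁ p.1 = true ∧ b₂ p.2 = true) ψ) (sem c₁) (sem c₂)
      (guard (fun p => b₁ p.1 = b₂ p.2) ψ)) :
    KernelValid (guard (fun p => b₁ p.1 = b₂ p.2) ψ) (sem (.loop b₁ c₁)) (sem (.loop b₂ c₂))
      (guard (fun p => b₁ p.1 = false ∧ b₂ p.2 = false) ψ) := by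
  have m₁ := fun n => tsum_loopApprox_le b₁ (tsum_sem_le c₁) n
  have m₂ := fun n => tsum_loopApprox_le b₂ (tsum_sem_le c₂) n
  have key : ∀ n, KernelValid (guard (fun p => b₁ p.1 = b₂ p.2) ψ) (loopApprox b₁ c₁ n)
      (loopApprox b₂ c₂ n) (guard (fun p => b₁ p.1 = false ∧ b₂ p.2 = false) ψ) := by
    intro n
    induction n with
    | zero =>
      intro σ₁ σ₂
      refine exists_isSubcoupling_prodMass (m₁ 0 σ₁) (m₂ 0 σ₂) ?_
      simp [loopApprox_zero, expect]
    | succ n ih =>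
      intro σ₁ σ₂
      by_cases hb : b₁ σ₁ = b₂ σ₂
      · rw [guard_of_pos (P := fun p : State Var₁ Val × State Var₂ Val => b₁ p.1 = b₂ p.2) hb,
          loopApprox_succ, loopApprox_succ, ← hb]
        by_cases h₁ : b₁ σ₁ = true
        · rw [if_pos h₁, if_pos h₁]
          refine ih.exists_push (m₁ n) (m₂ n) (tsum_sem_le c₁ σ₁) ?_
          obtain ⟨ν, hν, hle⟩ := h σ₁ σ₂
          exact ⟨ν, hν, hle.trans_eq (if_pos ⟨h₁, hb ▸ h₁⟩)⟩
        · rw [if_neg h₁, if_neg h₁]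
          have h₁' : b₁ σ₁ = false := by simpa using h₁
          exact exists_isSubcoupling_pure (guard_of_pos ⟨h₁', hb ▸ h₁'⟩ _).le
      · rw [guard_of_neg (P := fun p : State Var₁ Val × State Var₂ Val => b₁ p.1 = b₂ p.2) hb]
        exact exists_isSubcoupling_prodMass (m₁ _ σ₁) (m₂ _ σ₂) le_top
  intro σ₁ σ₂
  exact exists_isSubcoupling_of_iSup
    (ne_top_of_le_ne_top ENNReal.one_ne_top (tsum_sem_le _ σ₁))
    (ne_top_of_le_ne_top ENNReal.one_ne_top (tsum_sem_le _ σ₂))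
    (fun n => loopApprox_le b₁ c₁ n σ₁) (fun n => loopApprox_le b₂ c₂ n σ₂)
    (tsum_loopApprox_mono b₁ c₁ σ₁) (tsum_loopApprox_mono b₂ c₂ σ₂)
    (tsum_sem_loop b₁ c₁ σ₁) (tsum_sem_loop b₂ c₂ σ₂) fun n => key n σ₁ σ₂

theorem kernelValid_loopL {ψ : Assn Var₁ Var₂ Val} {c₁ : Cmd Var₁ Val}
    (b₁ : State Var₁ Val → Bool)
    (h : KernelValid (guard (fun p => b₁ p.1 = true) ψ) (sem c₁) (sem .skip) ψ) :
    KernelValid ψ (sem (.loop b₁ c₁)) (sem .skip) (guard (fun p => b₁ p.1 = false) ψ) := by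
  have m₁ := fun n => tsum_loopApprox_le b₁ (tsum_sem_le c₁) n
  have key : ∀ n, KernelValid ψ (loopApprox b₁ c₁ n) (sem .skip)
      (guard (fun p => b₁ p.1 = false) ψ) := by
    intro n
    induction n with
    | zero =>
      intro σ₁ σ₂
      refine exists_isSubcoupling_prodMass (m₁ 0 σ₁) (tsum_sem_le .skip σ₂) ?_
      simp [loopApprox_zero, expect]
    | succ n ih =>
      intro σ₁ σ₂
      rw [loopApprox_succ]
      by_cases h₁ : b₁ σ₁ = true
      · rw [if_pos h₁, ← push_pure (sem .skip) σ₂]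
        refine ih.exists_push (m₁ n) (tsum_sem_le .skip) (tsum_sem_le c₁ σ₁) ?_
        obtain ⟨ν, hν, hle⟩ := h σ₁ σ₂
        exact ⟨ν, hν, hle.trans_eq (if_pos h₁)⟩
      · rw [if_neg h₁]
        exact exists_isSubcoupling_pure (guard_of_pos (by simpa using h₁) _).le
  intro σ₁ σ₂
  refine exists_isSubcoupling_of_iSup
    (ne_top_of_le_ne_top ENNReal.one_ne_top (tsum_sem_le _ σ₁))
    (ne_top_of_le_ne_top ENNReal.one_ne_top (tsum_sem_le _ σ₂))
    (fun n => loopApprox_le b₁ c₁ n σ₁) (l₂ := fun _ => sem .skip σ₂) (fun _ _ => le_rfl)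
    (tsum_loopApprox_mono b₁ c₁ σ₁) monotone_const (tsum_sem_loop b₁ c₁ σ₁) ?_
    fun n => key n σ₁ σ₂
  rw [iSup_const]

theorem kernelValid_loopR {ψ : Assn Var₁ Var₂ Val} {c₂ : Cmd Var₂ Val}
    (b₂ : State Var₂ Val → Bool)
    (h : KernelValid (guard (fun p => b₂ p.2 = true) ψ) (sem .skip) (sem c₂) ψ) :
    KernelValid ψ (sem .skip) (sem (.loop b₂ c₂)) (guard (fun p => b₂ p.2 = false) ψ) := by
  have m₂ := fun n => tsum_loopApprox_le b₂ (tsum_sem_le c₂) n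
  have key : ∀ n, KernelValid ψ (sem .skip) (loopApprox b₂ c₂ n)
      (guard (fun p => b₂ p.2 = false) ψ) := by
    intro n
    induction n with
    | zero =>
      intro σ₁ σ₂
      refine exists_isSubcoupling_prodMass (tsum_sem_le .skip σ₁) (m₂ 0 σ₂) ?_
      simp [loopApprox_zero, expect]
    | succ n ih =>
      intro σ₁ σ₂
      rw [loopApprox_succ]
      by_cases h₂ : b₂ σ₂ = true
      · rw [if_pos h₂, ← push_pure (sem .skip) σ₁]
        refine ih.exists_push (tsum_sem_le .skip) (m₂ n) (tsum_pure σ₁).le ?_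
        obtain ⟨ν, hν, hle⟩ := h σ₁ σ₂
        exact ⟨ν, hν, hle.trans_eq (if_pos h₂)⟩
      · rw [if_neg h₂]
        exact exists_isSubcoupling_pure (guard_of_pos (by simpa using h₂) _).le
  intro σ₁ σ₂
  refine exists_isSubcoupling_of_iSup
    (ne_top_of_le_ne_top ENNReal.one_ne_top (tsum_sem_le _ σ₁))
    (ne_top_of_le_ne_top ENNReal.one_ne_top (tsum_sem_le _ σ₂))
    (l₁ := fun _ => sem .skip σ₁) (fun _ _ => le_rfl) (fun n => loopApprox_le b₂ c₂ n σ₂)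
    monotone_const (tsum_loopApprox_mono b₂ c₂ σ₂) ?_ (tsum_sem_loop b₂ c₂ σ₂)
    fun n => key n σ₁ σ₂
  rw [iSup_const]

/-- No termination is assumed, since a derivation for AST commands may pass through commands that
diverge, such as a loop in a dead branch. -/
theorem Derivable.kernelValid {strict : Prop} {ψ φ : Assn Var₁ Var₂ Val} {c₁ : Cmd Var₁ Val}
    {c₂ : Cmd Var₂ Val} (h : Derivable strict ψ c₁ c₂ φ) :
    KernelValid ψ (sem c₁) (sem c₂) φ := by
  induction h with
  | skip ψ => exact fun σ₁ σ₂ => exists_isSubcoupling_pure le_rfl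
  | assign ψ x₁ e₁ x₂ e₂ => exact fun σ₁ σ₂ => exists_isSubcoupling_pure le_rfl
  | seq _ _ ih ih' =>
    exact fun σ₁ σ₂ => ih'.exists_push (tsum_sem_le _) (tsum_sem_le _) (tsum_sem_le _ σ₁)
      (ih σ₁ σ₂)
  | @cond ψ φ c₁ c₁' c₂ c₂' b₁ b₂ _ _ ih ih' =>
    intro σ₁ σ₂
    by_cases hb : b₁ σ₁ = b₂ σ₂
    · rw [guard_of_pos (P := fun p : State Var₁ Val × State Var₂ Val => b₁ p.1 = b₂ p.2) hb]
      simp only [sem, ← hb]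
      by_cases h₁ : b₁ σ₁ = true
      · rw [if_pos h₁, if_pos h₁]
        obtain ⟨ν, hν, hle⟩ := ih σ₁ σ₂
        exact ⟨ν, hν, hle.trans_eq (if_pos ⟨h₁, hb ▸ h₁⟩)⟩
      · rw [if_neg h₁, if_neg h₁]
        have h₁' : b₁ σ₁ = false := by simpa using h₁
        obtain ⟨ν, hν, hle⟩ := ih' σ₁ σ₂
        exact ⟨ν, hν, hle.trans_eq (if_pos ⟨h₁', hb ▸ h₁'⟩)⟩
    · rw [guard_of_neg (P := fun p : State Var₁ Val × State Var₂ Val => b₁ p.1 = b₂ p.2) hb]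
      exact exists_isSubcoupling_prodMass (tsum_sem_le _ σ₁) (tsum_sem_le _ σ₂) le_top
  | loop b₁ b₂ _ ih => exact kernelValid_loop b₁ b₂ ih
  | @sample ψ φ x₁ d₁ x₂ d₂ hd =>
    intro σ₁ σ₂
    rw [sem_sample, sem_sample]
    obtain ⟨ν, hν, hle⟩ := hd σ₁ σ₂
    refine KernelValid.exists_push
      (ξ := fun v => φ (Function.update σ₁ x₁ v.1, Function.update σ₂ x₂ v.2))
      (fun v w => exists_isSubcoupling_pure le_rfl) (fun _ => (tsum_pure _).le)
      (fun _ => (tsum_pure _).le) (d₁ σ₁).tsum_coe.le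
      ⟨ν, hν.isSubcoupling (d₁ σ₁).tsum_coe.le, hle⟩
  | assignL ψ x₁ e₁ => exact fun σ₁ σ₂ => exists_isSubcoupling_pure le_rfl
  | assignR ψ x₂ e₂ => exact fun σ₁ σ₂ => exists_isSubcoupling_pure le_rfl
  | sampleL ψ x₁ d₁ =>
    intro σ₁ σ₂
    refine exists_isSubcoupling_prodMass (tsum_sem_le _ σ₁) (tsum_sem_le _ σ₂) ?_
    rw [sem_sample, expect_push]
    simp only [sem, expect_pure, le_refl]
  | sampleR ψ x₂ d₂ =>
    intro σ₁ σ₂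
    refine exists_isSubcoupling_prodMass (tsum_sem_le _ σ₁) (tsum_sem_le _ σ₂) ?_
    simp only [sem_sample, expect_push]
    simp only [sem, expect_pure, le_refl]
  | condL b₁ _ _ ih ih' =>
    intro σ₁ σ₂
    simp only [sem]
    by_cases h₁ : b₁ σ₁ = true
    · rw [if_pos h₁]
      obtain ⟨ν, hν, hle⟩ := ih σ₁ σ₂
      exact ⟨ν, hν, hle.trans_eq (if_pos h₁)⟩
    · rw [if_neg h₁]
      obtain ⟨ν, hν, hle⟩ := ih' σ₁ σ₂
      exact ⟨ν, hν, hle.trans_eq (if_pos (by simpa using h₁))⟩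
  | condR b₂ _ _ ih ih' =>
    intro σ₁ σ₂
    simp only [sem]
    by_cases h₂ : b₂ σ₂ = true
    · rw [if_pos h₂]
      obtain ⟨ν, hν, hle⟩ := ih σ₁ σ₂
      exact ⟨ν, hν, hle.trans_eq (if_pos h₂)⟩
    · rw [if_neg h₂]
      obtain ⟨ν, hν, hle⟩ := ih' σ₁ σ₂
      exact ⟨ν, hν, hle.trans_eq (if_pos (by simpa using h₂))⟩
  | loopL b₁ _ _ ih => exact kernelValid_loopL b₁ ih
  | loopR b₂ _ _ ih => exact kernelValid_loopR b₂ ih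
  | skipEquiv h₁ h₂ _ ih => rwa [← h₁.sem_eq, ← h₂.sem_eq]
  | conseq _ himp ih => exact ih.conseq (tsum_sem_le _) (tsum_sem_le _) himp
  | @nmodL ψ φ c₁ c₂ x₁ hx _ ih =>
    intro σ₁ σ₂
    -- With `v` the initial value of `x₁`, the update in the postcondition is the identity on the
    -- support of `ν`, where `x₁` keeps that value.
    obtain ⟨ν, hν, hle⟩ := ih (σ₁ x₁) σ₁ σ₂
    refine ⟨ν, hν, le_trans ?_ (hle.trans_eq (if_pos rfl))⟩
    refine ENNReal.tsum_le_tsum fun p => ?_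
    by_cases hp : ν p = 0
    · simp [hp]
    · have hx₁ : p.1 x₁ = σ₁ x₁ := sem_ne_zero_apply_eq hx fun h0 =>
        hp (le_antisymm ((le_margL ν p).trans ((hν.1 p.1).trans h0.le)) zero_le)
      simp only [← hx₁, Function.update_eq_self, le_refl]
  | @nmodR ψ φ c₁ c₂ x₂ hx _ ih =>
    intro σ₁ σ₂
    obtain ⟨ν, hν, hle⟩ := ih (σ₂ x₂) σ₁ σ₂
    refine ⟨ν, hν, le_trans ?_ (hle.trans_eq (if_pos rfl))⟩
    refine ENNReal.tsum_le_tsum fun p => ?_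
    by_cases hp : ν p = 0
    · simp [hp]
    · have hx₂ : p.2 x₂ = σ₂ x₂ := sem_ne_zero_apply_eq hx fun h0 =>
        hp (le_antisymm ((le_margR ν p).trans ((hν.2.1 p.2).trans h0.le)) zero_le)
      simp only [← hx₂, Function.update_eq_self, le_refl]
  | unboundedDuality h₁ h₂ _ ih =>
    intro σ₁ σ₂
    -- Each premise bounds one dual value: a split assertion has the same expectation under every
    -- coupling. The resulting ν comes from duality, not from any single premise.
    obtain ⟨ν, hν, hle⟩ := exists_isCoupling_of_dual_le (h₁ σ₁) (h₂ σ₂)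
      fun n φ₁ φ₂ hmem => by
        obtain ⟨ν, hν, hle⟩ := ih n φ₁ φ₂ hmem σ₁ σ₂
        have hc := hν.isCoupling (h₁ σ₁) (h₂ σ₂)
        rw [← hc.1, ← hc.2, expect_margL, expect_margR, ← expect_add]
        exact hle
    exact ⟨ν, hν.isSubcoupling (h₁ σ₁).le, hle⟩

end Soundness

/-! ### Completeness by one-sided weakest pre-expectations -/

section Completeness

variable {Var₁ Var₂ Val : Type*} [DecidableEq Var₁] [DecidableEq Var₂]

theorem Derivable.weaken {strict : Prop} {ψ ψ' φ φ' : Assn Var₁ Var₂ Val} {c₁ : Cmd Var₁ Val}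
    {c₂ : Cmd Var₂ Val} (h : Derivable strict ψ' c₁ c₂ φ') (hψ : ∀ p, ψ' p ≤ ψ p)
    (hφ : ∀ p, φ p ≤ φ' p) : Derivable strict ψ c₁ c₂ φ :=
  .conseq h fun _ _ _ _ _ _ hle =>
    ((iInf₂_mono fun _ _ => expect_mono (fun _ => le_rfl) hφ).trans hle).trans
      (expect_mono (fun _ => le_rfl) hψ)

/-- The one-sided rules derive the weakest pre-expectation of a command on the left. -/
theorem derivable_wpL {strict : Prop} (c : Cmd Var₁ Val) (hc : strict → HAST c)
    (φ : Assn Var₁ Var₂ Val) :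
    Derivable strict (fun p => expect (sem c p.1) fun τ => φ (τ, p.2)) c .skip φ := by
  induction c generalizing φ with
  | skip =>
    simp only [sem, expect_pure]
    exact .skip φ
  | assign x e =>
    simp only [sem, expect_pure]
    exact .assignL φ x e
  | sample x d =>
    simp only [sem_sample, expect_push, expect_pure]
    exact .sampleL φ x d
  | seq c c' ih ih' =>
    -- Seq needs a composition on both sides, so `skip` is replaced by `skip; skip`.
    refine .skipEquiv (.refl _) (.skip_seq .skip) ?_
    refine .seq ?_ (ih' (fun h => (hc h).2) φ)
    simp only [sem, expect_push]
    exact ih (fun h => (hc h).1) fun p => expect (sem c' p.1) fun τ => φ (τ, p.2)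
  | cond b c c' ih ih' =>
    refine .condL b ((ih (fun h => (hc h).1) φ).weaken (fun p => ?_) fun _ => le_rfl)
      ((ih' (fun h => (hc h).2) φ).weaken (fun p => ?_) fun _ => le_rfl)
    · refine le_guard_of_imp fun hb => ?_
      simp only [sem, hb, if_true, le_refl]
    · refine le_guard_of_imp fun hb => ?_
      simp [sem, hb]
  | loop b c ih =>
    -- The invariant is the weakest pre-expectation of the loop itself: unfolding once shows that an
    -- iteration preserves it, and that it equals `φ` where the guard is false.
    refine (Derivable.loopL b (fun h => (hc h).2) ((ih (fun h => (hc h).1) _).weaken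
      (fun p => ?_) fun _ => le_rfl)).weaken (fun _ => le_rfl) fun p => ?_
    · refine le_guard_of_imp fun hb => ?_
      conv_rhs => rw [sem_loop_unfold, if_pos hb, expect_push]
    · refine le_guard_of_imp fun hb => ?_
      rw [sem_loop_unfold]
      simp [hb, expect_pure]

/-- The one-sided rules derive the weakest pre-expectation of a command on the right. -/
theorem derivable_wpR {strict : Prop} (c : Cmd Var₂ Val) (hc : strict → HAST c)
    (φ : Assn Var₁ Var₂ Val) :
    Derivable strict (fun p => expect (sem c p.2) fun τ => φ (p.1, τ)) .skip c φ := by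
  induction c generalizing φ with
  | skip =>
    simp only [sem, expect_pure]
    exact .skip φ
  | assign x e =>
    simp only [sem, expect_pure]
    exact .assignR φ x e
  | sample x d =>
    simp only [sem_sample, expect_push, expect_pure]
    exact .sampleR φ x d
  | seq c c' ih ih' =>
    refine .skipEquiv (.skip_seq .skip) (.refl _) ?_
    refine .seq ?_ (ih' (fun h => (hc h).2) φ)
    simp only [sem, expect_push]
    exact ih (fun h => (hc h).1) fun p => expect (sem c' p.2) fun τ => φ (p.1, τ)
  | cond b c c' ih ih' =>
    refine .condR b ((ih (fun h => (hc h).1) φ).weaken (fun p => ?_) fun _ => le_rfl)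
      ((ih' (fun h => (hc h).2) φ).weaken (fun p => ?_) fun _ => le_rfl)
    · refine le_guard_of_imp fun hb => ?_
      simp only [sem, hb, if_true, le_refl]
    · refine le_guard_of_imp fun hb => ?_
      simp [sem, hb]
  | loop b c ih =>
    refine (Derivable.loopR b (fun h => (hc h).2) ((ih (fun h => (hc h).1) _).weaken
      (fun p => ?_) fun _ => le_rfl)).weaken (fun _ => le_rfl) fun p => ?_
    · refine le_guard_of_imp fun hb => ?_
      conv_rhs => rw [sem_loop_unfold, if_pos hb, expect_push]
    · refine le_guard_of_imp fun hb => ?_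
      rw [sem_loop_unfold]
      simp [hb, expect_pure]

/-- After duality, `c₁; skip` against `skip; c₂` suffices. The computed pre-expectation is the sum
of two marginal expectations, so it can be evaluated under the coupling `ν` that validity provides.
-/
theorem KernelValid.derivable {strict : Prop} {ψ φ : Assn Var₁ Var₂ Val} {c₁ : Cmd Var₁ Val}
    {c₂ : Cmd Var₂ Val} (h₁ : AST c₁) (h₂ : AST c₂) (hc₁ : strict → HAST c₁)
    (hc₂ : strict → HAST c₂) (h : KernelValid ψ (sem c₁) (sem c₂) φ) :
    Derivable strict ψ c₁ c₂ φ := by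
  refine .unboundedDuality h₁ h₂ fun n φ₁ φ₂ hmem => ?_
  refine .skipEquiv (.seq_skip c₁) (.skip_seq c₂) ?_
  refine Derivable.weaken (.seq (derivable_wpL c₁ hc₁ _) (derivable_wpR c₂ hc₂ (split φ₁ φ₂)))
    (fun p => ?_) fun _ => le_rfl
  obtain ⟨ν, hν, hle⟩ := h p.1 p.2
  have hc := hν.isCoupling (h₁ p.1) (h₂ p.2)
  have hν1 : ∑' x, ν x = 1 := by rw [← tsum_margL, hc.1, h₁]
  calc (expect (sem c₁ p.1) fun τ₁ => expect (sem c₂ p.2) fun τ₂ => split φ₁ φ₂ (τ₁, τ₂))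
      = expect (sem c₁ p.1) φ₁ + expect (sem c₂ p.2) φ₂ := by
        simp only [split, expect_add, expect_const, h₁ p.1, h₂ p.2, one_mul]
    _ = expect ν (split φ₁ φ₂) := by
        rw [← hc.1, ← hc.2, expect_margL, expect_margR, ← expect_add]
        rfl
    _ ≤ expect ν fun x => φ x + n := expect_mono (fun _ => le_rfl) hmem.2.2
    _ ≤ ψ p + n := by
        rw [expect_add, expect_const, hν1, one_mul]
        exact add_le_add_left hle _

end Completeness

/-! ### Comparison of the notions of validity for AST commands -/

section Validity

variable {Var₁ Var₂ Val : Type*} [DecidableEq Var₁] [DecidableEq Var₂]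

theorem tsum_option_of_none {A : Type*} {f : Option A → ℝ≥0∞} (h : f none = 0) :
    ∑' o, f o = ∑' a, f (some a) := by
  refine ((Option.some_injective A).tsum_eq fun o ho => ?_).symm
  cases o with
  | none => exact absurd h ho
  | some a => exact ⟨a, rfl⟩

/-- Under AST the completions put no mass on ⋆, so extension by zero and restriction to proper
outcomes translate couplings back and forth. -/
theorem kernelValid_iff_starValid {ψ φ : Assn Var₁ Var₂ Val} {c₁ : Cmd Var₁ Val}
    {c₂ : Cmd Var₂ Val} (h₁ : AST c₁) (h₂ : AST c₂) :
    KernelValid ψ (sem c₁) (sem c₂) φ ↔ StarValid ψ c₁ c₂ φ := by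
  constructor
  · intro h σ₁ σ₂
    obtain ⟨ν, hν, hle⟩ := h σ₁ σ₂
    have hc := hν.isCoupling (h₁ σ₁) (h₂ σ₂)
    refine ⟨starExt ν, ⟨?_, ?_⟩, ?_⟩
    · funext o
      cases o with
      | none => simp [margL, star, starExt, h₁ σ₁]
      | some a =>
        rw [margL, tsum_option_of_none rfl]
        exact congrFun hc.1 a
    · funext o
      cases o with
      | none => simp [margR, star, starExt, h₂ σ₂]
      | some b =>
        rw [margR, tsum_option_of_none rfl]
        exact congrFun hc.2 b
    · refine le_trans (le_of_eq ?_) hle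
      rw [expect, ENNReal.tsum_prod', tsum_option_of_none (by simp [starExt]), expect,
        ENNReal.tsum_prod']
      refine tsum_congr fun a => ?_
      rw [tsum_option_of_none (by simp [starExt])]
      rfl
  · intro h σ₁ σ₂
    obtain ⟨ν, hν, hle⟩ := h σ₁ σ₂
    have hL : ∀ b, ν (none, b) = 0 := fun b => le_antisymm
      ((le_margL ν _).trans (by rw [hν.1]; simp [star, h₁ σ₁])) zero_le
    have hR : ∀ a, ν (a, none) = 0 := fun a => le_antisymm
      ((le_margR ν _).trans (by rw [hν.2]; simp [star, h₂ σ₂])) zero_le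
    have hc : IsCoupling (fun p => ν (some p.1, some p.2)) (sem c₁ σ₁) (sem c₂ σ₂) := by
      constructor
      · funext a
        rw [margL, ← tsum_option_of_none (f := fun o => ν (some a, o)) (hR _)]
        exact congrFun hν.1 (some a)
      · funext b
        rw [margR, ← tsum_option_of_none (f := fun o => ν (o, some b)) (hL _)]
        exact congrFun hν.2 (some b)
    refine ⟨_, hc.isSubcoupling (h₁ σ₁).le, le_trans (le_of_eq ?_) hle⟩
    conv_rhs => rw [expect, ENNReal.tsum_prod', tsum_option_of_none (by simp [starExt])]
    rw [expect, ENNReal.tsum_prod']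
    refine tsum_congr fun a => ?_
    conv_rhs => rw [tsum_option_of_none (by simp [starExt])]
    rfl

theorem margL_pure {A B : Type*} (p : A × B) : margL ⇑(PMF.pure p) = ⇑(PMF.pure p.1) := by
  rw [← push_pure_kernel (margL _), push_margL, push_pure]

theorem margR_pure {A B : Type*} (p : A × B) : margR ⇑(PMF.pure p) = ⇑(PMF.pure p.2) := by
  rw [← push_pure_kernel (margR _), push_margR, push_pure]

theorem kernelValid_iff_valid {ψ φ : Assn Var₁ Var₂ Val} {c₁ : Cmd Var₁ Val}
    {c₂ : Cmd Var₂ Val} (h₁ : AST c₁) (h₂ : AST c₂) :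
    KernelValid ψ (sem c₁) (sem c₂) φ ↔ Valid ψ c₁ c₂ φ := by
  constructor
  · intro h μ hμ
    choose κ hκ hle using h
    have hc := fun p : State Var₁ Val × State Var₂ Val =>
      (hκ p.1 p.2).isCoupling (h₁ p.1) (h₂ p.2)
    -- The chosen pointwise couplings are mixed according to `μ`.
    refine ⟨push (fun p => κ p.1 p.2) μ, tsum_push_le (fun p => ?_) hμ, ⟨?_, ?_⟩, ?_⟩
    · rw [← tsum_margL, (hc p).1, h₁]
    · simp only [margL_push, fun p => (hc p).1, run, push_margL]
    · simp only [margR_push, fun p => (hc p).2, run, push_margR]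
    · rw [expect_push]
      exact expect_mono (fun _ => le_rfl) fun p => hle p.1 p.2
  · intro h σ₁ σ₂
    obtain ⟨ν, -, hν, hle⟩ := h ⇑(PMF.pure (σ₁, σ₂)) (tsum_pure _).le
    rw [margL_pure, margR_pure, run, run, push_pure, push_pure] at hν
    rw [expect_pure] at hle
    exact ⟨ν, hν.isSubcoupling (h₁ σ₁).le, hle⟩

end Validity

end ERHL

theorem mainTheorem5 {Var₁ Var₂ Val : Type*} [DecidableEq Var₁] [DecidableEq Var₂]
    [Finite Var₁] [Finite Var₂] [Countable Val]
    (c₁ : ERHL.Cmd Var₁ Val) (c₂ : ERHL.Cmd Var₂ Val) :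
    (ERHL.AST c₁ → ERHL.AST c₂ → ∀ ψ φ : ERHL.Assn Var₁ Var₂ Val,
      (ERHL.Derivable False ψ c₁ c₂ φ ↔ ERHL.StarValid ψ c₁ c₂ φ) ∧
      (ERHL.Derivable False ψ c₁ c₂ φ ↔ ERHL.Valid ψ c₁ c₂ φ)) ∧
    (ERHL.HAST c₁ → ERHL.HAST c₂ → ∀ ψ φ : ERHL.Assn Var₁ Var₂ Val,
      (ERHL.Derivable True ψ c₁ c₂ φ ↔ ERHL.Valid ψ c₁ c₂ φ)) := by
  refine ⟨fun h₁ h₂ ψ φ => ?_, fun h₁ h₂ ψ φ => ?_⟩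
  · have h : ERHL.Derivable False ψ c₁ c₂ φ ↔ ERHL.KernelValid ψ (ERHL.sem c₁) (ERHL.sem c₂) φ :=
      ⟨ERHL.Derivable.kernelValid, ERHL.KernelValid.derivable h₁ h₂ False.elim False.elim⟩
    exact ⟨h.trans (ERHL.kernelValid_iff_starValid h₁ h₂),
      h.trans (ERHL.kernelValid_iff_valid h₁ h₂)⟩
  · exact Iff.trans ⟨ERHL.Derivable.kernelValid,
      ERHL.KernelValid.derivable h₁.ast h₂.ast (fun _ => h₁) fun _ => h₂⟩
      (ERHL.kernelValid_iff_valid h₁.ast h₂.ast)
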